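/- **Setting.** Let $m\ge 1$ and let $(p_i,y_i)$, $i=1,\dots,m$, be calibration points with $k$ classes: $p_i\in\Delta^{k-1}$ (the probability simplex) and $y_i\in\{0,1\}^k$ one-hot. Let $\sigma_i$ be an order permutation of $p_i$, i.e. $(p_i)_{\sigma_i^{-1}(1)}\ge\cdots\ge (p_i)_{\sigma_i^{-1}(k)}$ (any choice in case of ties). For $1\le r\le k-1$ put $$q_{i,r}=\sum_{\sigma_i(j)\le r}(p_i)_j,\qquad \tilde y_{i,r}=\sum_{\sigma_i(j)\le r}(y_i)_j\in\{0,1\}.$$ The sorted cumulative isotonic regression problem is to minimise $$-\sum_{i=1}^m\sum_{r=1}^{k-1}\Big(\tilde y_{i,r}\log g(q_{i,r},r)+(1-\tilde y_{i,r})\log\big(1-g(q_{i,r},r)\big)\Big)\in[0,\infty]$$ (with $\log 0=-\infty$, $0\cdot\infty=0$) over all $g:[0,1]\times\{1,\dots,k-1\}\to[0,1]$ with $g(q,r)\le g(s,t)$ whenever $q\le s$ and $r\le t$. **Method.** Compute the points $(q_{i,r},r)$, sort them by $q$, then by $r$, and pool the data at equal positions into one point with weight the total number of data and value their mean. This gives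 a list $\mathcal X$ of at most $N=m(k-1)$ weighted points. Split recursively: for a nonempty sublist $X=(x_1,\dots,x_n)$, with $x_i$ of rank $l_i$, value $y_i$ and weight $w_i>0$, let $b=\mathrm{Avg}(X)=\sum w_iy_i/\sum w_i$ and compute, for $i=n,\dots,1$ and $j=1,\dots,k$, with $M[n+1,\cdot]=0$ and $v_i=w_i(y_i-b)$, $$M[i,j]=\begin{cases}M[i+1,j]+v_i,& j\le l_i,\\ \max\big(M[i+1,j],\,M[i+1,l_i]+v_i\big),& j>l_i,\end{cases}$$ and trace the choices back from column $k$ to obtain a subset $U\subseteq X$. If $U=\emptyset$ or $U=X$, assign the value $b$ to all of $X$; otherwise treat $X\setminus U$ and $U$ in the same way. **Proposition.** There is an absolute constant $C$ such that the following holds, where time is the number of elementary steps (arithmetic operations and comparisons of two real numbers or two indices, creations of a list cell, function calls). 1. For every nonempty list $X$ of $n$ weighted points at distinct positions in $\mathbb R\times\{1,\dots,k-1\}$, sorted as above, with real values and positive weights, the dynamic program returns in at most $C\,n\,k$ steps a maximal upper set $U$ of $X$ for the coordinatewise order, i.e. an upper set maximising $H_X(U)=\sum_{x_i\in U}w_i(y_i-\mathrm{Avg}(X))$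 among all upper sets of $X$. If $L=X\setminus U$ and $U$ are both nonempty, then $(L,U)$ is a projection pair: $L$ is a lower set, $U$ is an upper set, and there is $d\in\mathbb R$ such that the weighted least-squares isotonic regression on $L$ is at most $d$ everywhere on $L$ and that on $U$ is at least $d$ everywhere on $U$. Since $\mathcal X$ is such a list with at most $N=m(k-1)$ points, every split costs $O(Nk)$. 2. For every calibration set as above, the method, from the calibration set to the fitted values, takes at most $C\,m^2k^4$ steps, and its output is exact: it is the table of the values, at the positions $(q_{i,r},r)$, of a minimiser $g$ of the sorted cumulative isotonic regression problem. -/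

import Mathlib

namespace SCIR

/-! ### The optimisation problem -/

section Problem

/-- `σ` orders the `k` scores `p`: `p (σ⁻¹ 0) ≥ p (σ⁻¹ 1) ≥ ⋯`.  Ranks inside `Fin k` are counted
from `0`, so class `j` has rank `σ j + 1`. -/
def IsOrderPerm {k : ℕ} (p : Fin k → ℝ) (σ : Equiv.Perm (Fin k)) : Prop :=
  Antitone fun r => p (σ.symm r)

/-- The one-hot vector of the class `c`. -/
def oneHot {k : ℕ} (c : Fin k) : Fin k → ℝ := Pi.single c 1

/-- `∑_{rank j ≤ r} v_j`. -/
def topSum {k : ℕ} (σ : Equiv.Perm (Fin k)) (v : Fin k → ℝ) (r : ℕ) : ℝ :=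
  ∑ j with (σ j : ℕ) + 1 ≤ r, v j

/-- The domain `[0,1] × {1, …, k-1}`; it carries the coordinatewise order of `ℝ × ℕ`. -/
def domain (k : ℕ) : Set (ℝ × ℕ) := Set.Icc 0 1 ×ˢ Set.Ico 1 k

/-- `-log t ∈ [0,∞]` for `t ∈ [0,1]`, with `-log 0 = ∞`. -/
noncomputable def negLog (t : ℝ) : ENNReal :=
  if 0 < t then ENNReal.ofReal (-Real.log t) else ⊤

/-- The Bernoulli negative log-likelihood of `g` on the aggregated sorted cumulative data of the
`m` calibration points `(p i, y i)`; one term for every `i` and every rank `1 ≤ r ≤ k-1`.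
In `[0,∞]` one has `0 * ∞ = 0`. -/
noncomputable def nll {m k : ℕ} (p y : Fin m → Fin k → ℝ) (σ : Fin m → Equiv.Perm (Fin k))
    (g : ℝ × ℕ → ℝ) : ENNReal :=
  ∑ i, ∑ r ∈ Finset.Ico 1 k,
    (ENNReal.ofReal (topSum (σ i) (y i) r) * negLog (g (topSum (σ i) (p i) r, r)) +
      ENNReal.ofReal (1 - topSum (σ i) (y i) r) * negLog (1 - g (topSum (σ i) (p i) r, r)))

/-- Probability-valued functions that are isotonic for the coordinatewise order. -/
def Feasible (k : ℕ) (g : ℝ × ℕ → ℝ) : Prop :=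
  Set.MapsTo g (domain k) (Set.Icc 0 1) ∧ MonotoneOn g (domain k)

/-- `g` solves the sorted cumulative isotonic regression problem. -/
def IsSolution {m k : ℕ} (p y : Fin m → Fin k → ℝ) (σ : Fin m → Equiv.Perm (Fin k))
    (g : ℝ × ℕ → ℝ) : Prop :=
  Feasible k g ∧ ∀ h, Feasible k h → nll p y σ g ≤ nll p y σ h

end Problem

/-! ### Counting elementary steps

A computation is carried out in the monad `Timed`, which adds up elementary steps.  One step is:
one arithmetic operation or comparison on two field elements or on two indices; the creation of
one list cell; one call of a function together with the case distinction on its arguments and the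
access to the components of a pair or record.  There is no other access to list entries, so that
reading the `n`-th entry of a list costs time proportional to `n`. -/

structure Timed (α : Type) where
  val : α
  steps : ℕ

instance : Monad Timed where
  pure a := ⟨a, 0⟩
  bind x f := ⟨(f x.val).val, x.steps + (f x.val).steps⟩

/-- The charge for one function call. -/
def tick : Timed Unit := ⟨(), 1⟩

section Primitives

variable {R : Type} [Field R] [LinearOrder R]

def addT (a b : R) : Timed R := ⟨a + b, 1⟩
def subT (a b : R) : Timed R := ⟨a - b, 1⟩
def mulT (a b : R) : Timed R := ⟨a * b, 1⟩
def divT (a b : R) : Timed R := ⟨a / b, 1⟩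
def ltT (a b : R) : Timed Bool := ⟨decide (a < b), 1⟩
def succT (a : ℕ) : Timed ℕ := ⟨a + 1, 1⟩
def predT (a : ℕ) : Timed ℕ := ⟨a - 1, 1⟩
def natLtT (a b : ℕ) : Timed Bool := ⟨decide (a < b), 1⟩
def natLeT (a b : ℕ) : Timed Bool := ⟨decide (a ≤ b), 1⟩
def natEqT (a b : ℕ) : Timed Bool := ⟨decide (a = b), 1⟩
def consT {α : Type} (a : α) (l : List α) : Timed (List α) := ⟨a :: l, 1⟩

end Primitives

section Lists

variable {α : Type}

def appendT : List α → List α → Timed (List α)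
  | [], l => do
    tick
    return l
  | a :: as, l => do
    tick
    let t ← appendT as l
    consT a t

/-- Insertion into a list, `before a b` telling whether `a` is to be placed in front of `b`. -/
def insertT (before : α → α → Timed Bool) (a : α) : List α → Timed (List α)
  | [] => do
    tick
    consT a []
  | b :: bs => do
    tick
    if ← before a b then
      consT a (b :: bs)
    else
      let t ← insertT before a bs
      consT b t

def sortT (before : α → α → Timed Bool) : List α → Timed (List α)
  | [] => do
    tick
    return []
  | a :: as => do
    tick
    let t ← sortT before as
    insertT before a t

/-- The `n`-th entry of a list, counted from `1`. -/
def nthT (dflt : α) : List α → ℕ → Timed α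
  | [], _ => do
    tick
    return dflt
  | a :: as, n => do
    tick
    if ← natLeT n 1 then
      return a
    else
      let n' ← predT n
      nthT dflt as n'

/-- `n` copies of `a`. -/
def replicateT (a : α) : ℕ → Timed (List α)
  | 0 => do
    tick
    return []
  | n + 1 => do
    tick
    let t ← replicateT a n
    consT a t

end Lists

/-! ### The algorithm

It is written for an arbitrary ordered field `R`, which it accesses only through the charged
primitives. -/

/-- A class of a calibration point: its score `p_j`, its label `y_j`, and a key that is consulted
only to break ties between equal scores. -/
structure ClassEntry (R : Type) where
  score : R
  tie : ℕ
  label : R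

/-- A weighted data point: position `(q, r)`, value `y`, weight `w`. -/
structure Pt (R : Type) where
  q : R
  r : ℕ
  y : R
  w : R

section Algorithm

variable {R : Type} [Field R] [LinearOrder R]

/-- Decreasing score, ties broken by the key. -/
def classBeforeT (a b : ClassEntry R) : Timed Bool := do
  tick
  if ← ltT b.score a.score then
    return true
  else if ← ltT a.score b.score then
    return false
  else
    natLtT a.tie b.tie

/-- Increasing first coordinate, then increasing second coordinate. -/
def ptBeforeT (a b : Pt R) : Timed Bool := do
  tick
  if ← ltT a.q b.q then
    return true
  else if ← ltT b.q a.q then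
    return false
  else
    natLtT a.r b.r

def samePosT (a b : Pt R) : Timed Bool := do
  tick
  if ← ltT a.q b.q then
    return false
  else if ← ltT b.q a.q then
    return false
  else
    natEqT a.r b.r

/-- Cumulative sums along the sorted classes; the last rank is left out. The arguments `r`, `q`, `y`
are the rank and the sums reached so far. -/
def cumulateT (r : ℕ) (q y : R) : List (ClassEntry R) → Timed (List (Pt R))
  | [] => do
    tick
    return []
  | [_] => do
    tick
    return []
  | e :: e' :: es => do
    tick
    let r' ← succT r
    let q' ← addT q e.score
    let y' ← addT y e.label
    let t ← cumulateT r' q' y' (e' :: es)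
    consT ⟨q', r', y', 1⟩ t

/-- All sorted cumulative data of a list of calibration points. -/
def collectT : List (List (ClassEntry R)) → Timed (List (Pt R))
  | [] => do
    tick
    return []
  | s :: ss => do
    tick
    let s' ← sortT classBeforeT s
    let c ← cumulateT 0 0 0 s'
    let t ← collectT ss
    appendT c t

/-- Two data points at the same position are replaced by one, with the total weight and the
weighted mean of the values. -/
def poolT (a b : Pt R) : Timed (Pt R) := do
  tick
  let w ← addT a.w b.w
  let s ← mulT a.w a.y
  let t ← mulT b.w b.y
  let u ← addT s t
  let y ← divT u w
  return ⟨a.q, a.r, y, w⟩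

/-- In a sorted list, pool all data points that share their position. -/
def mergeT : List (Pt R) → Timed (List (Pt R))
  | [] => do
    tick
    return []
  | x :: xs => do
    tick
    match ← mergeT xs with
    | [] => consT x []
    | z :: zs =>
      if ← samePosT x z then
        let u ← poolT x z
        consT u zs
      else
        consT x (z :: zs)

/-- The pooled data set, sorted by the first, then by the second coordinate. -/
def aggregateT (V : List (List (ClassEntry R))) : Timed (List (Pt R)) := do
  tick
  let c ← collectT V
  let s ← sortT ptBeforeT c
  mergeT s

/-- `(∑ w y, ∑ w)`. -/
def sumsT : List (Pt R) → Timed (R × R)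
  | [] => do
    tick
    return (0, 0)
  | x :: xs => do
    tick
    let s ← sumsT xs
    let t ← mulT x.w x.y
    let a ← addT t s.1
    let b ← addT x.w s.2
    return (a, b)

/-- The weighted mean. -/
def avgT (X : List (Pt R)) : Timed R := do
  tick
  let s ← sumsT X
  divT s.1 s.2

/-- Row `i` of the tables `M` and `R` from row `i+1` of `M`, for a point of rank `l`: here
`v = w_i (y_i - b)` and `inc = M[i+1, l] + v`; the column index `j` runs along the row. -/
def rowT (l : ℕ) (v inc : R) : ℕ → List R → Timed (List R × List ℕ)
  | _, [] => do
    tick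
    return ([], [])
  | j, mj :: ms => do
    tick
    let j' ← succT j
    let t ← rowT l v inc j' ms
    if ← natLeT j l then
      let a ← addT mj v
      let row ← consT a t.1
      let choice ← consT j t.2
      return (row, choice)
    else if ← ltT inc mj then
      let row ← consT mj t.1
      let choice ← consT j t.2
      return (row, choice)
    else
      let row ← consT inc t.1
      let choice ← consT l t.2
      return (row, choice)

/-- The first row of `M` and all rows of `R`, with `c` columns and reference value `b`. -/
def tableT (b : R) (c : ℕ) : List (Pt R) → Timed (List R × List (List ℕ))
  | [] => do
    tick
    let z ← replicateT 0 c
    return (z, [])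
  | x :: xs => do
    tick
    let t ← tableT b c xs
    let d ← subT x.y b
    let v ← mulT x.w d
    let a ← nthT 0 t.1 x.r
    let inc ← addT a v
    let u ← rowT x.r v inc 1 t.1
    let choices ← consT u.2 t.2
    return (u.1, choices)

/-- Trace the choices back from column `j`; the points are distributed to the complement (first
component) and to the upper set (second component). -/
def traceT : ℕ → List (Pt R) → List (List ℕ) → Timed (List (Pt R) × List (Pt R))
  | j, x :: xs, choice :: choices => do
    tick
    let j' ← nthT 0 choice j
    let t ← traceT j' xs choices
    if ← natLeT j' x.r then
      let U ← consT x t.2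
      return (t.1, U)
    else
      let L ← consT x t.1
      return (L, t.2)
  | _, _, _ => do
    tick
    return ([], [])

/-- The grid dynamic program with columns `1, …, c`: it returns a maximal upper set as the second
component and its complement as the first. -/
def maxUpperSetT (c : ℕ) (X : List (Pt R)) : Timed (List (Pt R) × List (Pt R)) := do
  tick
  let b ← avgT X
  let t ← tableT b c X
  traceT c X t.2

/-- Assign the value `b` to all positions of a list. -/
def constantT (b : R) : List (Pt R) → Timed (List ((R × ℕ) × R))
  | [] => do
    tick
    return []
  | x :: xs => do
    tick
    let t ← constantT b xs
    consT ((x.q, x.r), b) t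

/-- Recursive splitting along maximal upper sets; when one of the two parts is empty, the mean is
assigned.  The first explicit argument bounds the depth of the recursion for the sake of
termination; since both parts of a split are smaller, the length of the list is large enough. -/
def splitSolveT (c : ℕ) : ℕ → List (Pt R) → Timed (List ((R × ℕ) × R))
  | 0, _ => return []
  | depth + 1, X => do
    tick
    match ← maxUpperSetT c X with
    | (l :: L, u :: U) => do
      let fL ← splitSolveT c depth (l :: L)
      let fU ← splitSolveT c depth (u :: U)
      appendT fL fU
    | _ => do
      let b ← avgT X
      constantT b X

/-- The whole method for `k` classes: from the calibration set to the list of the fitted values,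
each with its position. -/
def fitT (k : ℕ) (V : List (List (ClassEntry R))) : Timed (List ((R × ℕ) × R)) := do
  tick
  let X ← aggregateT V
  splitSolveT k X.length X

end Algorithm

/-- The calibration set as the algorithm receives it; `σ` serves only to break ties. -/
def inputData {m k : ℕ} (p y : Fin m → Fin k → ℝ) (σ : Fin m → Equiv.Perm (Fin k)) :
    List (List (ClassEntry ℝ)) :=
  List.ofFn fun i => List.ofFn fun j => ⟨p i j, σ i j, y i j⟩

/-! ### Upper sets and projection pairs

Finite sets of data points are given as duplicate-free lists, their subsets as sublists. -/

section Sets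

def Pt.pos (x : Pt ℝ) : ℝ × ℕ := (x.q, x.r)

/-- The inputs of the dynamic program: points at distinct positions, sorted by the first, then by
the second coordinate, with ranks in `{1, …, k-1}` and positive weights. -/
def IsGrid (k : ℕ) (X : List (Pt ℝ)) : Prop :=
  X.Pairwise (fun a b => a.q < b.q ∨ (a.q = b.q ∧ a.r < b.r)) ∧
    ∀ x ∈ X, 1 ≤ x.r ∧ x.r < k ∧ 0 < x.w

def IsUpperIn (X U : List (Pt ℝ)) : Prop :=
  U.Sublist X ∧ ∀ x ∈ U, ∀ z ∈ X, x.pos ≤ z.pos → z ∈ U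

def IsLowerIn (X L : List (Pt ℝ)) : Prop :=
  L.Sublist X ∧ ∀ x ∈ L, ∀ z ∈ X, z.pos ≤ x.pos → z ∈ L

/-- The weighted mean. -/
noncomputable def avg (S : List (Pt ℝ)) : ℝ :=
  (S.map fun x => x.w * x.y).sum / (S.map fun x => x.w).sum

/-- `H_X(S) = ∑_{x ∈ S} w_x (y_x - Avg X)`. -/
noncomputable def excess (X S : List (Pt ℝ)) : ℝ :=
  (S.map fun x => x.w * (x.y - avg X)).sum

def IsMaximalUpperSet (X U : List (Pt ℝ)) : Prop :=
  IsUpperIn X U ∧ ∀ U', IsUpperIn X U' → excess X U' ≤ excess X U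

def IsotonicOn (S : List (Pt ℝ)) (f : ℝ × ℕ → ℝ) : Prop :=
  ∀ x ∈ S, ∀ z ∈ S, x.pos ≤ z.pos → f x.pos ≤ f z.pos

/-- Weighted least-squares isotonic regression on `S`. -/
def IsIsotonicRegression (S : List (Pt ℝ)) (f : ℝ × ℕ → ℝ) : Prop :=
  IsotonicOn S f ∧ ∀ h, IsotonicOn S h →
    (S.map fun x => x.w * (f x.pos - x.y) ^ 2).sum ≤
      (S.map fun x => x.w * (h x.pos - x.y) ^ 2).sum

/-- `X` is the disjoint union of the lower set `L` and the upper set `U`, and some number separates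
the isotonic regressions on `L` and on `U`. -/
def IsProjectionPair (X L U : List (Pt ℝ)) : Prop :=
  (L ++ U).Perm X ∧ IsLowerIn X L ∧ IsUpperIn X U ∧
    ∃ fL fU : ℝ × ℕ → ℝ, IsIsotonicRegression L fL ∧ IsIsotonicRegression U fU ∧
      ∃ d : ℝ, ∀ x ∈ L, ∀ z ∈ U, fL x.pos ≤ d ∧ d ≤ fU z.pos

end Sets

end SCIR

/-!
The table entry `M[i, j]` is the largest score of an upper set of the suffix starting at `i` that
contains all its points of rank at least `j`: in sorted order, an upper set that contains the first
point, of rank `l`, contains all points of rank at least `l`, and this is its only constraint on the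
rest.  Hence tracing back from column `k` produces a maximal upper set.

The isotonic fits on a maximal upper set and on its complement are separated by the mean `b` of the
data.  Indeed, by maximality no lower part of the upper set has a negative total of the residuals
`y - b`, while the fit averages the data over its level sets; dually for the complement.  Gluing the
two fits therefore keeps monotonicity.  Where no split is possible, all upper sets have a
nonpositive total of residuals, so that every isotonic function correlates nonpositively with the
residuals.  Comparing with the tangent at `b`, the constant `b` is then optimal for the squared loss
as well as for the logarithmic loss.  Optimality of the pieces adds up, and an isotonic fit on the
data positions extends to the whole domain.

A split may cut off a single point, so the recursion costs at most the sum of `n k` over all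
`n ≤ N`, that is `O(N² k)` with `N = m (k - 1)`, and sorting costs `O(N²)`.
-/

namespace SCIR

/-! ### Timed computations and lists -/

section Timed

variable {α β : Type}

@[simp] theorem bind_val (x : Timed α) (f : α → Timed β) : (x >>= f).val = (f x.val).val := rfl

@[simp] theorem bind_steps (x : Timed α) (f : α → Timed β) :
    (x >>= f).steps = x.steps + (f x.val).steps := rfl

@[simp] theorem pure_val (a : α) : (pure a : Timed α).val = a := rfl

@[simp] theorem pure_steps (a : α) : (pure a : Timed α).steps = 0 := rfl

attribute [simps] tick addT subT mulT divT ltT succT predT natLtT natLeT natEqT consT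

end Timed

section Lists

variable {α : Type}

@[simp] theorem appendT_val (l l' : List α) : (appendT l l').val = l ++ l' := by
  induction l with
  | nil => simp [appendT]
  | cons a l ih => simp [appendT, ih]

@[simp] theorem appendT_steps (l l' : List α) : (appendT l l').steps = 2 * l.length + 1 := by
  induction l with
  | nil => simp [appendT]
  | cons a l ih =>
    simp only [appendT, bind_steps, tick_steps, ih, consT_steps, List.length_cons]
    ring

@[simp] theorem replicateT_val (a : α) (n : ℕ) : (replicateT a n).val = List.replicate n a := by
  induction n with
  | zero => simp [replicateT]
  | succ n ih => simp [replicateT, ih, List.replicate_succ]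

@[simp] theorem replicateT_steps (a : α) (n : ℕ) : (replicateT a n).steps = 2 * n + 1 := by
  induction n with
  | zero => simp [replicateT]
  | succ n ih => simp only [replicateT, bind_steps, tick_steps, ih, consT_steps]; ring

@[simp] theorem nthT_val (d : α) (l : List α) (n : ℕ) : (nthT d l n).val = l.getD (n - 1) d := by
  induction l generalizing n with
  | nil => simp [nthT]
  | cons a l ih =>
    simp only [nthT, bind_val, natLeT_val, decide_eq_true_eq]
    split_ifs with h
    · simp [Nat.sub_eq_zero_of_le h]
    · obtain ⟨n, rfl⟩ := Nat.exists_eq_add_of_le' (not_le.1 h)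
      simp [ih]

theorem nthT_steps_le (d : α) (l : List α) (n : ℕ) : (nthT d l n).steps ≤ 3 * l.length + 1 := by
  induction l generalizing n with
  | nil => simp [nthT]
  | cons a l ih =>
    have := ih (n - 1)
    simp only [nthT, bind_steps, tick_steps, natLeT_steps, apply_ite Timed.steps, pure_steps,
      predT_steps, predT_val, List.length_cons]
    split_ifs <;> lia

end Lists

section Sorting

variable {α : Type} (before : α → α → Timed Bool)

theorem insertT_perm (a : α) (l : List α) : (insertT before a l).val.Perm (a :: l) := by
  induction l with
  | nil => simp [insertT]
  | cons b l ih =>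
    simp only [insertT, bind_val]
    split
    · simp
    · simpa using (ih.cons b).trans (List.Perm.swap a b l)

theorem sortT_perm (l : List α) : (sortT before l).val.Perm l := by
  induction l with
  | nil => simp [sortT]
  | cons a l ih => simpa [sortT] using (insertT_perm before a _).trans (ih.cons a)

@[simp] theorem sortT_length (l : List α) : (sortT before l).val.length = l.length :=
  (sortT_perm before l).length_eq

theorem insertT_steps_le {b : ℕ} (hb : ∀ x z, (before x z).steps ≤ b) (a : α) (l : List α) :
    (insertT before a l).steps ≤ (b + 2) * l.length + 2 := by
  induction l with
  | nil => simp [insertT]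
  | cons x l ih =>
    have := hb a x
    simp only [insertT, bind_steps, tick_steps, apply_ite Timed.steps, consT_steps,
      List.length_cons, Nat.mul_succ]
    split_ifs <;> lia

theorem sortT_steps_le {b : ℕ} (hb : ∀ x z, (before x z).steps ≤ b) (l : List α) :
    (sortT before l).steps ≤ (b + 2) * l.length ^ 2 + 3 * l.length + 1 := by
  induction l with
  | nil => simp [sortT]
  | cons a l ih =>
    have h := insertT_steps_le before hb a (sortT before l).val
    rw [sortT_length] at h
    simp only [sortT, bind_steps, tick_steps, List.length_cons]
    nlinarith

variable {β : Type} [LinearOrder β] (key : α → β)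

theorem insertT_pairwise_le (hkey : ∀ a b, (before a b).val = decide (key a < key b)) (a : α)
    {l : List α} (hl : l.Pairwise fun x z => key x ≤ key z) :
    (insertT before a l).val.Pairwise fun x z => key x ≤ key z := by
  induction l with
  | nil => simp [insertT]
  | cons b l ih =>
    have hbl := List.pairwise_cons.1 hl
    simp only [insertT, bind_val, hkey, decide_eq_true_eq]
    split_ifs with hab
    · exact List.pairwise_cons.2 ⟨by simpa using
        ⟨hab.le, fun c hc => hab.le.trans (hbl.1 c hc)⟩, hl⟩
    · refine List.pairwise_cons.2 ⟨fun c hc => ?_, ih hbl.2⟩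
      rcases List.mem_cons.1 ((insertT_perm before a l).mem_iff.1 hc) with rfl | hc
      · exact not_lt.1 hab
      · exact hbl.1 c hc

theorem sortT_pairwise_le (hkey : ∀ a b, (before a b).val = decide (key a < key b)) (l : List α) :
    (sortT before l).val.Pairwise fun x z => key x ≤ key z := by
  induction l with
  | nil => simp [sortT]
  | cons a l ih => simpa [sortT] using insertT_pairwise_le before key hkey a ih

end Sorting

/-! ### Running times -/

section Cumulation

variable {R : Type} [Field R]

theorem cumulateT_length (r : ℕ) (q y : R) (l : List (ClassEntry R)) :
    (cumulateT r q y l).val.length = l.length - 1 := by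
  induction l generalizing r q y with
  | nil => simp [cumulateT]
  | cons e l ih =>
    cases l with
    | nil => simp [cumulateT]
    | cons e' l => simp [cumulateT, ih]

theorem cumulateT_steps_le (r : ℕ) (q y : R) (l : List (ClassEntry R)) :
    (cumulateT r q y l).steps ≤ 5 * l.length + 1 := by
  induction l generalizing r q y with
  | nil => simp [cumulateT]
  | cons e l ih =>
    cases l with
    | nil => simp [cumulateT]
    | cons e' l =>
      have := ih (r + 1) (q + e.score) (y + e.label)
      simp only [cumulateT, bind_steps, tick_steps, succT_steps, addT_steps, consT_steps,
        succT_val, addT_val, List.length_cons] at this ⊢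
      lia

@[simp] theorem sumsT_val (X : List (Pt R)) :
    (sumsT X).val = ((X.map fun x => x.w * x.y).sum, (X.map fun x => x.w).sum) := by
  induction X with
  | nil => simp [sumsT]
  | cons x X ih => simp [sumsT, ih]

theorem sumsT_steps (X : List (Pt R)) : (sumsT X).steps = 4 * X.length + 1 := by
  induction X with
  | nil => simp [sumsT]
  | cons x X ih => simp [sumsT, ih]; ring

theorem avgT_steps (X : List (Pt R)) : (avgT X).steps = 4 * X.length + 3 := by
  simp [avgT, sumsT_steps]; ring

end Cumulation

section TraceConstant

variable {R : Type}

@[simp] theorem constantT_val (b : R) (X : List (Pt R)) :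
    (constantT b X).val = X.map fun x => ((x.q, x.r), b) := by
  induction X with
  | nil => simp [constantT]
  | cons x X ih => simp [constantT, ih]

theorem constantT_steps (b : R) (X : List (Pt R)) :
    (constantT b X).steps = 2 * X.length + 1 := by
  induction X with
  | nil => simp [constantT]
  | cons x X ih => simp [constantT, ih]; ring

theorem traceT_steps_le {c : ℕ} (j : ℕ) (X : List (Pt R)) {T : List (List ℕ)}
    (hT : ∀ s ∈ T, s.length = c) : (traceT j X T).steps ≤ X.length * (3 * c + 4) + 1 := by
  induction X generalizing j T with
  | nil => simp [traceT]
  | cons x X ih =>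
    cases T with
    | nil => simp [traceT]
    | cons s T =>
      simp only [List.mem_cons, forall_eq_or_imp] at hT
      have hnth := nthT_steps_le 0 s j
      have htrace := ih (s.getD (j - 1) 0) hT.2
      rw [hT.1] at hnth
      simp only [traceT, bind_steps, tick_steps, natLeT_steps, nthT_val, apply_ite Timed.steps,
        consT_steps, pure_steps, List.length_cons, Nat.succ_mul]
      split_ifs <;> lia

theorem traceT_perm (j : ℕ) (X : List (Pt R)) {T : List (List ℕ)} (hT : T.length = X.length) :
    ((traceT j X T).val.1 ++ (traceT j X T).val.2).Perm X := by
  induction X generalizing j T with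
  | nil => simp [traceT]
  | cons x X ih =>
    obtain ⟨s, T, rfl⟩ := List.exists_cons_of_length_eq_add_one hT
    have := ih (s.getD (j - 1) 0) (Nat.succ.inj hT)
    simp only [traceT, bind_val, nthT_val]
    split_ifs
    · exact List.perm_middle.trans (this.cons x)
    · exact this.cons x

theorem traceT_fst_sublist (j : ℕ) (X : List (Pt R)) (T : List (List ℕ)) :
    (traceT j X T).val.1.Sublist X := by
  induction X generalizing j T with
  | nil => simp [traceT]
  | cons x X ih =>
    cases T with
    | nil => simp [traceT]
    | cons s T =>
      simp only [traceT, bind_val, nthT_val]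
      split_ifs
      · exact (ih _ T).cons x
      · exact (ih _ T).cons_cons x

end TraceConstant

section Comparison

variable {R : Type} [LinearOrder R]

theorem classBeforeT_steps_le (a b : ClassEntry R) : (classBeforeT a b).steps ≤ 4 := by
  simp only [classBeforeT, bind_steps, apply_ite Timed.steps]
  split_ifs <;> simp

theorem ptBeforeT_steps_le (a b : Pt R) : (ptBeforeT a b).steps ≤ 4 := by
  simp only [ptBeforeT, bind_steps, apply_ite Timed.steps]
  split_ifs <;> simp

theorem samePosT_steps_le (a b : Pt R) : (samePosT a b).steps ≤ 4 := by
  simp only [samePosT, bind_steps, apply_ite Timed.steps]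
  split_ifs <;> simp

theorem samePosT_val (a b : Pt R) : (samePosT a b).val = decide (a.q = b.q ∧ a.r = b.r) := by
  rcases lt_trichotomy a.q b.q with h | h | h
  · simp [samePosT, h, h.ne]
  · simp [samePosT, h]
  · simp [samePosT, h, h.not_gt, h.ne']

end Comparison

variable {R : Type} [Field R] [LinearOrder R]

section Aggregation

theorem collectT_length {k : ℕ} {V : List (List (ClassEntry R))} (hV : ∀ s ∈ V, s.length = k) :
    (collectT V).val.length = V.length * (k - 1) := by
  induction V with
  | nil => simp [collectT]
  | cons s V ih =>
    simp only [List.mem_cons, forall_eq_or_imp] at hV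
    simp only [collectT, bind_val, appendT_val, List.length_append, cumulateT_length,
      sortT_length, hV.1, ih hV.2, List.length_cons]
    ring

theorem collectT_steps_le {k : ℕ} {V : List (List (ClassEntry R))} (hV : ∀ s ∈ V, s.length = k) :
    (collectT V).steps ≤ V.length * (6 * k ^ 2 + 10 * k + 4) + 1 := by
  induction V with
  | nil => simp [collectT]
  | cons s V ih =>
    simp only [List.mem_cons, forall_eq_or_imp] at hV
    have hsort := sortT_steps_le classBeforeT classBeforeT_steps_le s
    have hcum := cumulateT_steps_le 0 0 0 (sortT classBeforeT s).val
    have hrec := ih hV.2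
    rw [sortT_length] at hcum
    simp only [collectT, bind_steps, tick_steps, appendT_steps, cumulateT_length, sortT_length,
      hV.1, List.length_cons, Nat.succ_mul] at hsort hcum ⊢
    lia

theorem mergeT_induction {motive : List (Pt R) → List (Pt R) → Prop} (nil : motive [] [])
    (keep : ∀ x X Z, (mergeT X).val = Z → motive X Z →
      (∀ z ∈ Z.head?, ¬(x.q = z.q ∧ x.r = z.r)) → motive (x :: X) (x :: Z))
    (pool : ∀ x X z Z, (mergeT X).val = z :: Z → motive X (z :: Z) → x.q = z.q ∧ x.r = z.r →
      motive (x :: X) ((poolT x z).val :: Z))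
    (X : List (Pt R)) : motive X (mergeT X).val := by
  induction X with
  | nil => exact nil
  | cons x X ih =>
    simp only [mergeT, bind_val]
    split
    next hZ => exact keep x X [] hZ (hZ ▸ ih) (by simp)
    next z Z hZ =>
      rw [hZ] at ih
      simp only [bind_val, samePosT_val, decide_eq_true_eq]
      split_ifs with hxz
      · exact pool x X z Z hZ ih hxz
      · exact keep x X (z :: Z) hZ ih (by simpa using hxz)

theorem mergeT_length_le (X : List (Pt R)) : (mergeT X).val.length ≤ X.length := by
  induction X using mergeT_induction with
  | nil => simp
  | keep x X Z _ ih _ => simpa using ih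
  | pool x X z Z _ ih _ => exact ih.trans (by simp)

theorem mergeT_steps_le (X : List (Pt R)) : (mergeT X).steps ≤ 12 * X.length + 1 := by
  induction X with
  | nil => simp [mergeT]
  | cons x X ih =>
    simp only [mergeT, bind_steps, tick_steps, List.length_cons]
    split
    · simp only [consT_steps]; lia
    next z Z _ =>
      have := samePosT_steps_le x z
      simp only [bind_steps, apply_ite Timed.steps, poolT, tick_steps, addT_steps, mulT_steps,
        divT_steps, pure_steps, consT_steps]
      split_ifs <;> lia

theorem aggregateT_length_le {k : ℕ} {V : List (List (ClassEntry R))}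
    (hV : ∀ s ∈ V, s.length = k) : (aggregateT V).val.length ≤ V.length * (k - 1) := by
  simpa [aggregateT, collectT_length hV] using
    mergeT_length_le (sortT ptBeforeT (collectT V).val).val

theorem aggregateT_steps_le {k : ℕ} {V : List (List (ClassEntry R))}
    (hV : ∀ s ∈ V, s.length = k) (hk : 0 < k) (hV₀ : V ≠ []) :
    (aggregateT V).steps ≤ 50 * (V.length ^ 2 * k ^ 2) := by
  have hcollect := collectT_steps_le hV
  have hsort := sortT_steps_le ptBeforeT ptBeforeT_steps_le (collectT V).val
  have hmerge := mergeT_steps_le (sortT ptBeforeT (collectT V).val).val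
  have hlen : (collectT V).val.length ≤ V.length * k :=
    (collectT_length hV).trans_le (Nat.mul_le_mul_left _ (k.sub_le 1))
  have hm : 0 < V.length := List.length_pos_iff.2 hV₀
  simp only [aggregateT, bind_steps, tick_steps, sortT_length] at hmerge ⊢
  generalize (collectT V).val.length = N at *
  generalize V.length = m at *
  have hN : N ^ 2 ≤ m ^ 2 * k ^ 2 := (Nat.pow_le_pow_left hlen 2).trans_eq (mul_pow m k 2)
  have hmk : m * k ≤ m ^ 2 * k ^ 2 := by
    rw [← mul_pow]
    exact Nat.le_self_pow two_ne_zero _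
  have hmk₂ : m * k ^ 2 ≤ m ^ 2 * k ^ 2 :=
    Nat.mul_le_mul_right _ (Nat.le_self_pow two_ne_zero m)
  have hmk₁ : m ≤ m * k := Nat.le_mul_of_pos_right _ hk
  nlinarith

end Aggregation

section Table

theorem rowT_steps_le (l : ℕ) (v inc : R) (j : ℕ) (ms : List R) :
    (rowT l v inc j ms).steps ≤ 6 * ms.length + 1 := by
  induction ms generalizing j with
  | nil => simp [rowT]
  | cons a ms ih =>
    have := ih (j + 1)
    simp only [rowT, bind_steps, tick_steps, succT_steps, succT_val, natLeT_steps,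
      apply_ite Timed.steps, addT_steps, ltT_steps, consT_steps, pure_steps, List.length_cons]
    split_ifs <;> lia

theorem rowT_val (l : ℕ) (v inc : R) (j : ℕ) (ms : List R) :
    (rowT l v inc j ms).val =
      (ms.mapIdx fun i a => if j + i ≤ l then a + v else max inc a,
        ms.mapIdx fun i a => if j + i ≤ l ∨ inc < a then j + i else l) := by
  induction ms generalizing j with
  | nil => simp [rowT]
  | cons a ms ih =>
    simp only [rowT, bind_val, succT_val, natLeT_val, decide_eq_true_eq, ih, apply_ite Timed.val,
      ltT_val, addT_val, consT_val, pure_val, List.mapIdx_cons, add_zero, max_def_lt,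
      add_assoc, add_comm 1]
    split_ifs <;> grind

@[simp] theorem tableT_fst_length (b : R) (c : ℕ) (X : List (Pt R)) :
    (tableT b c X).val.1.length = c := by
  induction X with
  | nil => simp [tableT]
  | cons x X ih => simp [tableT, rowT_val, ih]

theorem tableT_snd_length (b : R) (c : ℕ) (X : List (Pt R)) :
    (tableT b c X).val.2.length = X.length := by
  induction X with
  | nil => simp [tableT]
  | cons x X ih => simp [tableT, ih]

theorem length_of_mem_tableT_snd {b : R} {c : ℕ} {X : List (Pt R)} {s : List ℕ}
    (hs : s ∈ (tableT b c X).val.2) : s.length = c := by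
  induction X with
  | nil => simp [tableT] at hs
  | cons x X ih =>
    simp only [tableT, bind_val, consT_val, pure_val, List.mem_cons] at hs
    rcases hs with rfl | hs
    · simp [rowT_val]
    · exact ih hs

theorem tableT_steps_le (b : R) (c : ℕ) (X : List (Pt R)) :
    (tableT b c X).steps ≤ X.length * (9 * c + 7) + 2 * c + 2 := by
  induction X with
  | nil => simp [tableT]; lia
  | cons x X ih =>
    have hnth := nthT_steps_le 0 (tableT b c X).val.1 x.r
    have hrow := rowT_steps_le x.r (x.w * (x.y - b))
      ((tableT b c X).val.1.getD (x.r - 1) 0 + x.w * (x.y - b)) 1 (tableT b c X).val.1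
    rw [tableT_fst_length] at hnth hrow
    simp only [tableT, bind_steps, tick_steps, subT_steps, subT_val, mulT_steps, mulT_val,
      nthT_val, addT_steps, addT_val, consT_steps, pure_steps, List.length_cons, Nat.succ_mul]
    lia

theorem maxUpperSetT_perm (c : ℕ) (X : List (Pt R)) :
    ((maxUpperSetT c X).val.1 ++ (maxUpperSetT c X).val.2).Perm X :=
  traceT_perm c X (tableT_snd_length _ c X)

theorem maxUpperSetT_fst_sublist (c : ℕ) (X : List (Pt R)) :
    (maxUpperSetT c X).val.1.Sublist X :=
  traceT_fst_sublist c X _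

theorem maxUpperSetT_steps_le {c : ℕ} (hc : 0 < c) {X : List (Pt R)} (hX : X ≠ []) :
    (maxUpperSetT c X).steps ≤ 40 * (X.length * c) := by
  have htable := tableT_steps_le (avgT X).val c X
  have htrace := traceT_steps_le c X fun s (hs : s ∈ (tableT (avgT X).val c X).val.2) =>
    length_of_mem_tableT_snd hs
  have hn : 0 < X.length := List.length_pos_iff.2 hX
  have hnc : X.length ≤ X.length * c := Nat.le_mul_of_pos_right _ hc
  have hcn : c ≤ X.length * c := Nat.le_mul_of_pos_left _ hn
  simp only [maxUpperSetT, bind_steps, tick_steps, avgT_steps]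
  nlinarith

end Table

section Splitting

variable {c : ℕ} {X : List (Pt R)}

theorem splitSolveT_succ_of_eq_nil (depth : ℕ)
    (h : (maxUpperSetT c X).val.1 = [] ∨ (maxUpperSetT c X).val.2 = []) :
    splitSolveT c (depth + 1) X = (do
      tick
      let _ ← maxUpperSetT c X
      let b ← avgT X
      constantT b X) := by
  rcases hrun : maxUpperSetT c X with ⟨⟨L, U⟩, n⟩
  simp only [splitSolveT, hrun] at h ⊢
  rcases h with rfl | rfl
  · rfl
  · cases L <;> rfl

theorem splitSolveT_succ_of_ne_nil (depth : ℕ) (hL : (maxUpperSetT c X).val.1 ≠ [])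
    (hU : (maxUpperSetT c X).val.2 ≠ []) :
    splitSolveT c (depth + 1) X = (do
      tick
      let s ← maxUpperSetT c X
      let fL ← splitSolveT c depth s.1
      let fU ← splitSolveT c depth s.2
      appendT fL fU) := by
  rcases hrun : maxUpperSetT c X with ⟨⟨L, U⟩, n⟩
  simp only [splitSolveT, hrun] at hL hU ⊢
  obtain ⟨l, L, rfl⟩ := List.exists_cons_of_ne_nil hL
  obtain ⟨u, U, rfl⟩ := List.exists_cons_of_ne_nil hU
  rfl

theorem maxUpperSetT_length_add (c : ℕ) (X : List (Pt R)) :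
    (maxUpperSetT c X).val.1.length + (maxUpperSetT c X).val.2.length = X.length := by
  simpa using (maxUpperSetT_perm c X).length_eq

theorem splitSolveT_length {depth : ℕ} (hX : X.length ≤ depth) :
    (splitSolveT c depth X).val.length = X.length := by
  induction depth generalizing X with
  | zero => simp_all [splitSolveT]
  | succ depth ih =>
    by_cases h : (maxUpperSetT c X).val.1 = [] ∨ (maxUpperSetT c X).val.2 = []
    · simp [splitSolveT_succ_of_eq_nil depth h]
    · obtain ⟨hL, hU⟩ := not_or.1 h
      have hadd := maxUpperSetT_length_add c X
      have hL₀ := List.length_pos_iff.2 hL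
      have hU₀ := List.length_pos_iff.2 hU
      simp only [splitSolveT_succ_of_ne_nil depth hL hU, bind_val, appendT_val, List.length_append]
      rw [ih (by lia), ih (by lia), hadd]

/-- The cost of a split is linear in the length, but a split may cut off a single point. -/
theorem splitSolveT_steps_le {depth : ℕ} (hc : 0 < c) (hX₀ : X ≠ []) (hX : X.length ≤ depth) :
    (splitSolveT c depth X).steps ≤ 60 * (X.length ^ 2 * c) := by
  induction depth generalizing X with
  | zero => simp_all
  | succ depth ih =>
    have hmax := maxUpperSetT_steps_le hc hX₀
    have hn := List.length_pos_iff.2 hX₀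
    by_cases h : (maxUpperSetT c X).val.1 = [] ∨ (maxUpperSetT c X).val.2 = []
    · simp only [splitSolveT_succ_of_eq_nil depth h, bind_steps, tick_steps, avgT_steps,
        constantT_steps]
      nlinarith [Nat.mul_le_mul hn hc, Nat.le_mul_of_pos_right X.length hc,
        Nat.mul_le_mul_right (X.length * c) hn]
    · obtain ⟨hL, hU⟩ := not_or.1 h
      have hadd := maxUpperSetT_length_add c X
      have hL₀ := List.length_pos_iff.2 hL
      have hU₀ := List.length_pos_iff.2 hU
      have hfL := ih hL (by lia)
      have hfU := ih hU (by lia)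
      simp only [splitSolveT_succ_of_ne_nil depth hL hU, bind_steps, tick_steps, appendT_steps]
      rw [splitSolveT_length (by lia)]
      generalize (maxUpperSetT c X).val.1.length = a at *
      generalize (maxUpperSetT c X).val.2.length = b at *
      rw [← hadd] at hmax ⊢
      have hab : a + b ≤ 2 * (a * b) := by nlinarith
      nlinarith [Nat.mul_le_mul_right c hab, Nat.le_mul_of_pos_right a hc]

theorem fitT_steps_le {k : ℕ} {V : List (List (ClassEntry R))} (hV : ∀ s ∈ V, s.length = k)
    (hk : 0 < k) (hV₀ : V ≠ []) : (fitT k V).steps ≤ 120 * (V.length ^ 2 * k ^ 4) := by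
  have hagg := aggregateT_steps_le hV hk hV₀
  have hlen : (aggregateT V).val.length ≤ V.length * k :=
    (aggregateT_length_le hV).trans (Nat.mul_le_mul_left _ (k.sub_le 1))
  have hpos : 0 < V.length ^ 2 * k ^ 2 := by have := List.length_pos_iff.2 hV₀; positivity
  have hsplit : (splitSolveT k (aggregateT V).val.length (aggregateT V).val).steps ≤
      60 * ((V.length * k) ^ 2 * k) := by
    rcases eq_or_ne (aggregateT V).val [] with hX | hX
    · simp [hX, splitSolveT]
    · exact (splitSolveT_steps_le hk hX le_rfl).trans (by gcongr)
  have hk₂ : V.length ^ 2 * k ^ 2 ≤ V.length ^ 2 * k ^ 4 := by gcongr; lia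
  have hk₃ : V.length ^ 2 * k ^ 3 ≤ V.length ^ 2 * k ^ 4 := by gcongr; lia
  simp only [fitT, bind_steps, tick_steps]
  linarith

end Splitting

/-! ### The dynamic program -/

section Recursion

variable {R : Type} [Field R] [LinearOrder R]

/-- The entry `M[1, j]` of the table of `X` with `c` columns and reference value `b`; as in the
paper, the columns are counted from `1`. -/
def tableEntry (b : R) (c : ℕ) (X : List (Pt R)) (j : ℕ) : R :=
  (tableT b c X).val.1.getD (j - 1) 0

/-- The partition of `X` that is found by tracing the choices in the table back from column `j`. -/
def tracedSplit (b : R) (c : ℕ) (X : List (Pt R)) (j : ℕ) : List (Pt R) × List (Pt R) :=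
  (traceT j X (tableT b c X).val.2).val

variable (b : R) (c : ℕ) (x : Pt R) (X : List (Pt R)) {j : ℕ}

@[simp] theorem tableEntry_nil (j : ℕ) : tableEntry b c [] j = 0 := by
  simp only [tableEntry, tableT, bind_val, replicateT_val, pure_val, List.getD_eq_getElem?_getD,
    List.getElem?_replicate]
  split_ifs <;> rfl

@[simp] theorem tracedSplit_nil (j : ℕ) : tracedSplit b c [] j = ([], []) := rfl

theorem tableT_cons_val :
    (tableT b c (x :: X)).val =
      let row := (rowT x.r (x.w * (x.y - b)) (tableEntry b c X x.r + x.w * (x.y - b)) 1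
        (tableT b c X).val.1).val
      (row.1, row.2 :: (tableT b c X).val.2) := by
  simp [tableT, tableEntry]

theorem tableEntry_cons (hj : 1 ≤ j) (hjc : j ≤ c) :
    tableEntry b c (x :: X) j =
      if j ≤ x.r then tableEntry b c X j + x.w * (x.y - b)
      else max (tableEntry b c X x.r + x.w * (x.y - b)) (tableEntry b c X j) := by
  have hlt : j - 1 < (tableT b c X).val.1.length := by rw [tableT_fst_length]; lia
  rw [tableEntry, tableT_cons_val, rowT_val, List.getD_eq_getElem _ _ (by simpa using hlt)]
  simp only [List.getElem_mapIdx, Nat.add_sub_cancel' hj]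
  rw [tableEntry, tableEntry, List.getD_eq_getElem _ _ hlt]

theorem tracedSplit_cons (hj : 1 ≤ j) (hjc : j ≤ c) :
    tracedSplit b c (x :: X) j =
      if j ≤ x.r ∨ tableEntry b c X j ≤ tableEntry b c X x.r + x.w * (x.y - b) then
        ((tracedSplit b c X (min j x.r)).1, x :: (tracedSplit b c X (min j x.r)).2)
      else (x :: (tracedSplit b c X j).1, (tracedSplit b c X j).2) := by
  have hlt : j - 1 < (tableT b c X).val.1.length := by rw [tableT_fst_length]; lia
  have hentry : tableEntry b c X j = (tableT b c X).val.1[j - 1] :=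
    List.getD_eq_getElem _ _ hlt
  rw [tracedSplit, tableT_cons_val, rowT_val]
  simp only [traceT, bind_val, nthT_val]
  rw [List.getD_eq_getElem _ _ (by simpa using hlt)]
  simp only [List.getElem_mapIdx, Nat.add_sub_cancel' hj, ← hentry, natLeT_val, decide_eq_true_eq,
    apply_ite Timed.val, bind_val, consT_val, pure_val, tracedSplit]
  by_cases hr : j ≤ x.r
  · simp [hr]
  · by_cases hinc : tableEntry b c X x.r + x.w * (x.y - b) < tableEntry b c X j
    · simp [hr, hinc, hinc.not_ge]
    · simp [hr, hinc, not_lt.1 hinc, (not_le.1 hr).le]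

end Recursion

section Order

/-- Data points are compared by their positions. -/
instance : Preorder (Pt ℝ) := Preorder.lift Pt.pos

/-- The position with the lexicographic order, in which the data points are sorted. -/
def Pt.lexPos (x : Pt ℝ) : ℝ ×ₗ ℕ := toLex x.pos

theorem Pt.lexPos_lt_lexPos_iff {x z : Pt ℝ} :
    x.lexPos < z.lexPos ↔ x.q < z.q ∨ x.q = z.q ∧ x.r < z.r :=
  Prod.Lex.toLex_lt_toLex

theorem Pt.lexPos_mono : Monotone Pt.lexPos := fun _ _ h => Prod.Lex.toLex_mono h

theorem Pt.le_of_lexPos_lt {x z : Pt ℝ} (h : x.lexPos < z.lexPos) (hr : x.r ≤ z.r) : x ≤ z :=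
  ⟨(Pt.lexPos_lt_lexPos_iff.1 h).elim le_of_lt fun h => h.1.le, hr⟩

end Order

section Correctness

variable {b : ℝ} {c j : ℕ} {x : Pt ℝ} {X U : List (Pt ℝ)}

/-- The score `H_X(S)` with an arbitrary reference value `b` in place of the mean of `X`. -/
def score (b : ℝ) (S : List (Pt ℝ)) : ℝ := (S.map fun x => x.w * (x.y - b)).sum

@[simp] theorem score_nil (b : ℝ) : score b [] = 0 := rfl

@[simp] theorem score_cons (b : ℝ) (x : Pt ℝ) (S : List (Pt ℝ)) :
    score b (x :: S) = x.w * (x.y - b) + score b S := by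
  simp [score]

/-- The upper sets of `X` that contain all points of rank at least `j`: the competitors of the
table entry in column `j`. -/
def IsUpperFrom (j : ℕ) (X U : List (Pt ℝ)) : Prop :=
  IsUpperIn X U ∧ ∀ z ∈ X, j ≤ z.r → z ∈ U

theorem IsUpperFrom.cons (hU : IsUpperFrom (min j x.r) X U) :
    IsUpperFrom j (x :: X) (x :: U) := by
  obtain ⟨⟨hsub, hup⟩, hrank⟩ := hU
  refine ⟨⟨hsub.cons_cons x, fun a ha z hz haz => ?_⟩, fun z hz hzj => ?_⟩
  · rcases List.mem_cons.1 hz with rfl | hzX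
    · exact List.mem_cons_self
    rcases List.mem_cons.1 ha with rfl | haU
    · exact List.mem_cons_of_mem _ (hrank z hzX (min_le_of_right_le haz.2))
    · exact List.mem_cons_of_mem _ (hup a haU z hzX haz)
  · rcases List.mem_cons.1 hz with rfl | hz
    · exact List.mem_cons_self
    · exact List.mem_cons_of_mem _ (hrank z hz (min_le_of_left_le hzj))

theorem IsUpperFrom.cons_left (hx : ∀ z ∈ X, x.lexPos < z.lexPos) (hr : x.r < j)
    (hU : IsUpperFrom j X U) : IsUpperFrom j (x :: X) U := by
  obtain ⟨⟨hsub, hup⟩, hrank⟩ := hU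
  refine ⟨⟨hsub.cons x, fun a ha z hz haz => ?_⟩, fun z hz hzj => ?_⟩
  · rcases List.mem_cons.1 hz with rfl | hz
    · exact absurd (Pt.lexPos_mono haz) (hx a (hsub.subset ha)).not_ge
    · exact hup a ha z hz haz
  · rcases List.mem_cons.1 hz with rfl | hz
    · exact absurd hzj hr.not_ge
    · exact hrank z hz hzj

theorem IsUpperFrom.cases_cons (hx : ∀ z ∈ X, x.lexPos < z.lexPos)
    (hU : IsUpperFrom j (x :: X) U) :
    (∃ V, U = x :: V ∧ IsUpperFrom (min j x.r) X V) ∨ (x.r < j ∧ IsUpperFrom j X U) := by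
  have hne : ∀ z ∈ X, z ≠ x := fun z hz hzx => (hx z hz).ne' (congrArg Pt.lexPos hzx)
  obtain ⟨⟨hsub, hup⟩, hrank⟩ := hU
  rcases List.sublist_cons_iff.1 hsub with hsub | ⟨V, rfl, hsubV⟩
  · refine .inr ⟨not_le.1 fun hr => hne x (hsub.subset (hrank x (by simp) hr)) rfl, ⟨hsub, ?_⟩, ?_⟩
    · exact fun a ha z hz => hup a ha z (by simp [hz])
    · exact fun z hz => hrank z (by simp [hz])
  · have mem_V : ∀ z ∈ X, z ∈ x :: V → z ∈ V := fun z hz hzV =>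
      (List.mem_cons.1 hzV).resolve_left (hne z hz)
    refine .inl ⟨V, rfl, ⟨hsubV, fun a ha z hz haz => ?_⟩, fun z hz hzr => ?_⟩
    · exact mem_V z hz (hup a (by simp [ha]) z (by simp [hz]) haz)
    · rcases min_le_iff.1 hzr with hzr | hzr
      · exact mem_V z hz (hrank z (by simp [hz]) hzr)
      · exact mem_V z hz (hup x (by simp) z (by simp [hz]) (Pt.le_of_lexPos_lt (hx z hz) hzr))

theorem IsUpperFrom.score_le_tableEntry (hX : X.Pairwise fun x z => x.lexPos < z.lexPos)
    (hr : ∀ x ∈ X, 1 ≤ x.r) (hj : 1 ≤ j) (hjc : j ≤ c) (hU : IsUpperFrom j X U) :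
    score b U ≤ tableEntry b c X j := by
  induction X generalizing j U with
  | nil => simp [List.sublist_nil.1 hU.1.1]
  | cons x X ih =>
    obtain ⟨hx, hX⟩ := List.pairwise_cons.1 hX
    obtain ⟨hxr, hr⟩ := List.forall_mem_cons.1 hr
    rw [tableEntry_cons b c x X hj hjc]
    rcases hU.cases_cons hx with ⟨V, rfl, hV⟩ | ⟨hlt, hU⟩
    · have := ih hX hr (le_min hj hxr) (min_le_of_left_le hjc) hV
      rw [score_cons, add_comm]
      split_ifs with hjx
      · rw [min_eq_left hjx] at this
        gcongr
      · rw [min_eq_right (not_le.1 hjx).le] at this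
        exact le_max_of_le_left (by gcongr)
    · rw [if_neg hlt.not_ge]
      exact le_max_of_le_right (ih hX hr hj hjc hU)

theorem isUpperFrom_tracedSplit (hX : X.Pairwise fun x z => x.lexPos < z.lexPos)
    (hr : ∀ x ∈ X, 1 ≤ x.r) (hj : 1 ≤ j) (hjc : j ≤ c) :
    IsUpperFrom j X (tracedSplit b c X j).2 := by
  induction X generalizing j with
  | nil => simp [IsUpperFrom, IsUpperIn]
  | cons x X ih =>
    obtain ⟨hx, hX⟩ := List.pairwise_cons.1 hX
    obtain ⟨hxr, hr⟩ := List.forall_mem_cons.1 hr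
    rw [tracedSplit_cons b c x X hj hjc]
    split_ifs with htake
    · exact (ih hX hr (le_min hj hxr) (min_le_of_left_le hjc)).cons
    · exact (ih hX hr hj hjc).cons_left hx (not_le.1 (not_or.1 htake).1)

theorem score_tracedSplit (hr : ∀ x ∈ X, 1 ≤ x.r) (hj : 1 ≤ j) (hjc : j ≤ c) :
    score b (tracedSplit b c X j).2 = tableEntry b c X j := by
  induction X generalizing j with
  | nil => simp
  | cons x X ih =>
    obtain ⟨hxr, hr⟩ := List.forall_mem_cons.1 hr
    rw [tracedSplit_cons b c x X hj hjc, tableEntry_cons b c x X hj hjc]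
    split_ifs with htake hjx hjx
    · rw [score_cons, ih hr (le_min hj hxr) (min_le_of_left_le hjc), min_eq_left hjx, add_comm]
    · rw [score_cons, ih hr (le_min hj hxr) (min_le_of_left_le hjc),
        min_eq_right (not_le.1 hjx).le, max_eq_left (htake.resolve_left hjx), add_comm]
    · exact absurd (.inl hjx) htake
    · rw [ih hr hj hjc, max_eq_right (not_le.1 (not_or.1 htake).2).le]

end Correctness

section Grid

variable {k : ℕ} {X Z : List (Pt ℝ)}

theorem IsGrid.pairwise_lexPos_lt (hX : IsGrid k X) :
    X.Pairwise fun x z => x.lexPos < z.lexPos :=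
  hX.1.imp Pt.lexPos_lt_lexPos_iff.2

theorem IsGrid.sublist (hX : IsGrid k X) (h : Z.Sublist X) : IsGrid k Z :=
  ⟨hX.1.sublist h, fun x hx => hX.2 x (h.subset hx)⟩

theorem IsGrid.pos_of_ne_nil (hX : IsGrid k X) (hX₀ : X ≠ []) : 0 < k := by
  obtain ⟨x, hx⟩ := List.exists_mem_of_ne_nil X hX₀
  exact (Nat.zero_le _).trans_lt (hX.2 x hx).2.1

theorem IsGrid.nodup_map_pos (hX : IsGrid k X) : (X.map Pt.pos).Nodup := by
  rw [List.Nodup, List.pairwise_map]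
  exact hX.pairwise_lexPos_lt.imp fun h hpos => h.ne (congrArg toLex hpos)

theorem IsGrid.nodup (hX : IsGrid k X) : X.Nodup := hX.nodup_map_pos.of_map

@[simp] theorem avgT_val (X : List (Pt ℝ)) : (avgT X).val = avg X := by simp [avgT, avg]

theorem maxUpperSetT_val (c : ℕ) (X : List (Pt ℝ)) :
    (maxUpperSetT c X).val = tracedSplit (avg X) c X c := by
  simp [maxUpperSetT, tracedSplit]

theorem isMaximalUpperSet_maxUpperSetT (hX : IsGrid k X) (hk : 0 < k) :
    IsMaximalUpperSet X (maxUpperSetT k X).val.2 := by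
  have hr : ∀ x ∈ X, 1 ≤ x.r := fun x hx => (hX.2 x hx).1
  rw [maxUpperSetT_val]
  refine ⟨(isUpperFrom_tracedSplit hX.pairwise_lexPos_lt hr hk le_rfl).1, fun U' hU' => ?_⟩
  have hU'k : IsUpperFrom k X U' := ⟨hU', fun z hz hkz => absurd (hX.2 z hz).2.1 hkz.not_gt⟩
  exact (hU'k.score_le_tableEntry hX.pairwise_lexPos_lt hr hk le_rfl).trans_eq
    (score_tracedSplit hr hk le_rfl).symm

end Grid

/-! ### Isotonic regression by splitting -/

section Isotonic

variable {ι R : Type*}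

section Order

variable [Preorder ι] {S U V : Finset ι}

/-- `V` is an upper set of the finite preorder `S`. -/
abbrev IsUpperSubset (S V : Finset ι) : Prop := IsRelUpperSet (V : Set ι) (· ∈ S)

theorem IsUpperSubset.subset (hV : IsUpperSubset S V) : V ⊆ S := fun _ hx => (hV hx).1

theorem IsUpperSubset.trans (hV : IsUpperSubset U V) (hU : IsUpperSubset S U) :
    IsUpperSubset S V := fun _ hx =>
  ⟨hU.subset (hV.subset hx), fun _ hxz hz => (hV hx).2 hxz ((hU (hV.subset hx)).2 hxz hz)⟩

theorem IsUpperSubset.union [DecidableEq ι] (hU : IsUpperSubset S U)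
    (hV : IsUpperSubset (S \ U) V) : IsUpperSubset S (V ∪ U) := by
  intro x hx
  simp only [Finset.coe_union, Set.mem_union, Finset.mem_coe] at hx ⊢
  rcases hx with hx | hx
  · refine ⟨(Finset.mem_sdiff.1 (hV hx).1).1, fun z hxz hz => ?_⟩
    exact or_iff_not_imp_right.2 fun hzU => (hV hx).2 hxz (Finset.mem_sdiff.2 ⟨hz, hzU⟩)
  · exact ⟨(hU hx).1, fun z hxz hz => .inr ((hU hx).2 hxz hz)⟩

end Order

variable [CommRing R] (w y : ι → R) {b c : R} {S U V : Finset ι}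

/-- The weighted sum of the residuals on `S` against the level `b`: the score `H` of the paper for
finite sets, with an arbitrary reference value. -/
def deviation (b : R) (S : Finset ι) : R := ∑ x ∈ S, w x * (y x - b)

variable {w y}

theorem deviation_sub_deviation (b c : R) (S : Finset ι) :
    deviation w y b S - deviation w y c S = (c - b) * ∑ x ∈ S, w x := by
  simp only [deviation, ← Finset.sum_sub_distrib, Finset.mul_sum]
  exact Finset.sum_congr rfl fun x _ => by ring

theorem deviation_union_of_subset_sdiff [DecidableEq ι] (b : R) (hV : V ⊆ S \ U) :
    deviation w y b (V ∪ U) = deviation w y b V + deviation w y b U :=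
  Finset.sum_union (Finset.disjoint_of_subset_left hV Finset.sdiff_disjoint)

variable [LinearOrder R]

section Definitions

variable [Preorder ι]

variable (w y) in
/-- `U` has the largest deviation from `b` among the upper sets of `S`. -/
def IsMaximalUpperSubset (b : R) (S U : Finset ι) : Prop :=
  IsUpperSubset S U ∧ ∀ V, IsUpperSubset S V → deviation w y b V ≤ deviation w y b U

variable (w y) in
/-- The mean of `S` is `b`, and no upper set of `S` has a larger mean. -/
def IsFlat (b : R) (S : Finset ι) : Prop :=
  deviation w y b S = 0 ∧ ∀ V, IsUpperSubset S V → deviation w y b V ≤ 0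

variable [DecidableEq ι]

variable (w y) in
/-- `g` arises on `S` by recursive splitting along maximal upper sets. -/
inductive SplitFit (g : ι → R) : Finset ι → Prop
  | flat (S : Finset ι) (b : R) (hne : S.Nonempty) (hS : IsFlat w y b S)
      (hg : ∀ x ∈ S, g x = b) : SplitFit g S
  | split (S U : Finset ι) (b : R) (hb : deviation w y b S = 0)
      (hmax : IsMaximalUpperSubset w y b S U) (hL : SplitFit g (S \ U)) (hU : SplitFit g U) :
      SplitFit g S

namespace SplitFit

variable {g g' : ι → R}

theorem nonempty (h : SplitFit w y g S) : S.Nonempty := by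
  induction h with
  | flat _ _ hne => exact hne
  | split _ _ _ _ _ _ _ ihL => exact ihL.mono Finset.sdiff_subset

theorem congr (h : SplitFit w y g S) (hg' : ∀ x ∈ S, g' x = g x) : SplitFit w y g' S := by
  induction h with
  | flat S b hne hS hg => exact .flat S b hne hS fun x hx => (hg' x hx).trans (hg x hx)
  | split S U b hb hmax _ _ ihL ihU =>
    exact .split S U b hb hmax (ihL fun x hx => hg' x (Finset.sdiff_subset hx))
      (ihU fun x hx => hg' x (hmax.1.subset hx))

theorem split_piecewise {gL gU : ι → R} (hb : deviation w y b S = 0)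
    (hmax : IsMaximalUpperSubset w y b S U) (hL : SplitFit w y gL (S \ U))
    (hU : SplitFit w y gU U) : SplitFit w y (U.piecewise gU gL) S :=
  .split S U b hb hmax
    (hL.congr fun _ hx => U.piecewise_eq_of_notMem gU gL (Finset.mem_sdiff.1 hx).2)
    (hU.congr fun _ hx => U.piecewise_eq_of_mem gU gL hx)

theorem sum_le_sum {M : Type*} [AddCommMonoid M] [PartialOrder M] [IsOrderedAddMonoid M]
    {f₀ f₁ : ι → M} (h : SplitFit w y g S)
    (hf : ∀ B ⊆ S, ∀ b, B.Nonempty → IsFlat w y b B → (∀ x ∈ B, g x = b) →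
      ∑ x ∈ B, f₀ x ≤ ∑ x ∈ B, f₁ x) :
    ∑ x ∈ S, f₀ x ≤ ∑ x ∈ S, f₁ x := by
  induction h with
  | flat S b hne hS hg => exact hf S subset_rfl b hne hS hg
  | split S U _ _ hmax _ _ ihL ihU =>
    have hUS := hmax.1.subset
    rw [← Finset.sum_sdiff hUS, ← Finset.sum_sdiff hUS]
    exact add_le_add (ihL fun B hB => hf B (hB.trans Finset.sdiff_subset))
      (ihU fun B hB => hf B (hB.trans hUS))

end SplitFit

end Definitions

variable [IsStrictOrderedRing R]

theorem deviation_le_deviation_iff (hS : S.Nonempty) (hw : ∀ x ∈ S, 0 < w x) :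
    deviation w y c S ≤ deviation w y b S ↔ b ≤ c := by
  rw [← sub_nonneg, deviation_sub_deviation, mul_nonneg_iff_of_pos_right (Finset.sum_pos hw hS),
    sub_nonneg]

theorem eq_of_deviation_eq_zero_of_ge (hw : ∀ x ∈ S, 0 < w x) (hy : ∀ x ∈ S, b ≤ y x)
    (hS : deviation w y b S = 0) : ∀ x ∈ S, y x = b := fun x hx =>
  sub_eq_zero.1 <| (mul_eq_zero.1 <| (Finset.sum_eq_zero_iff_of_nonneg fun z hz =>
    mul_nonneg (hw z hz).le (sub_nonneg.2 (hy z hz))).1 hS x hx).resolve_left (hw x hx).ne'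

theorem eq_of_deviation_eq_zero_of_le (hw : ∀ x ∈ S, 0 < w x) (hy : ∀ x ∈ S, y x ≤ b)
    (hS : deviation w y b S = 0) : ∀ x ∈ S, y x = b := fun x hx =>
  sub_eq_zero.1 <| (mul_eq_zero.1 <| (Finset.sum_eq_zero_iff_of_nonpos fun z hz =>
    mul_nonpos_of_nonneg_of_nonpos (hw z hz).le (sub_nonpos.2 (hy z hz))).1 hS x hx).resolve_left
      (hw x hx).ne'

theorem sum_mul_sub_nonpos_of_superlevel {v h : ι → R}
    (hc : ∀ x ∈ S, c ≤ h x) (hle : ∀ t > c, ∑ x ∈ S with t ≤ h x, v x ≤ 0) :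
    ∑ x ∈ S, v x * (h x - c) ≤ 0 := by
  classical
  induction S using Finset.induction_on_min_value h generalizing c with
  | empty => simp
  | insert a s ha hmin ih =>
    have hs : ∑ x ∈ s, v x * (h x - h a) ≤ 0 := by
      refine ih hmin fun t ht => ?_
      have := hle t ((hc a (Finset.mem_insert_self a s)).trans_lt ht)
      rwa [Finset.filter_insert, if_neg ht.not_ge] at this
    have hconst : (h a - c) * ∑ x ∈ insert a s, v x ≤ 0 := by
      rcases (hc a (Finset.mem_insert_self a s)).eq_or_lt with hac | hac
      · simp [hac]
      · have := hle (h a) hac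
        rw [Finset.filter_true_of_mem (by simpa using hmin)] at this
        exact mul_nonpos_of_nonneg_of_nonpos (sub_nonneg.2 hac.le) this
    calc ∑ x ∈ insert a s, v x * (h x - c)
        = ∑ x ∈ s, v x * (h x - h a) + (h a - c) * ∑ x ∈ insert a s, v x := by
          rw [Finset.sum_insert ha, Finset.sum_insert ha, mul_add, Finset.mul_sum, add_left_comm,
            ← Finset.sum_add_distrib, mul_comm (v a)]
          exact congrArg _ (Finset.sum_congr rfl fun x _ => by ring)
      _ ≤ 0 := add_nonpos hs hconst

variable [Preorder ι]

theorem IsFlat.sum_mul_nonpos (hS : IsFlat w y b S) {f : ι → R} (hf : MonotoneOn f S) :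
    ∑ x ∈ S, w x * (y x - b) * (f x - b) ≤ 0 := by
  obtain ⟨c, hc⟩ := (S.image f).bddBelow
  have hsuper : ∑ x ∈ S, w x * (y x - b) * (f x - c) ≤ 0 := by
    refine sum_mul_sub_nonpos_of_superlevel (fun x hx => hc (Finset.mem_image_of_mem f hx))
      fun t _ => hS.2 _ fun x hx => ?_
    simp only [Finset.coe_filter, Set.mem_ofPred_eq] at hx ⊢
    exact ⟨hx.1, fun z hxz hz => ⟨hz, hx.2.trans (hf hx.1 hz hxz)⟩⟩
  calc ∑ x ∈ S, w x * (y x - b) * (f x - b)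
      = ∑ x ∈ S, w x * (y x - b) * (f x - c) + deviation w y b S * (c - b) := by
        rw [deviation, Finset.sum_mul, ← Finset.sum_add_distrib]
        exact Finset.sum_congr rfl fun x _ => by ring
    _ ≤ 0 := by rwa [hS.1, zero_mul, add_zero]

variable [DecidableEq ι]

theorem IsMaximalUpperSubset.deviation_nonpos (hU : IsMaximalUpperSubset w y b S U)
    (hV : IsUpperSubset (S \ U) V) : deviation w y b V ≤ 0 := by
  have := hU.2 _ (hU.1.union hV)
  rw [deviation_union_of_subset_sdiff b hV.subset] at this
  exact nonpos_of_add_le_left this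

namespace SplitFit

variable {g : ι → R}

theorem le_of_forall_deviation_nonpos (h : SplitFit w y g S) (hw : ∀ x ∈ S, 0 < w x)
    (hc : ∀ V, IsUpperSubset S V → deviation w y c V ≤ 0) : ∀ x ∈ S, g x ≤ c := by
  induction h generalizing c with
  | flat S b hne hS hg =>
    intro x hx
    rw [hg x hx, ← deviation_le_deviation_iff hne hw, hS.1]
    exact hc S isRelUpperSet_self
  | split S U b hb hmax _ hU ihL ihU =>
    have hbc : b ≤ c := by
      rw [← deviation_le_deviation_iff (hU.nonempty.mono hmax.1.subset) hw, hb]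
      exact hc S isRelUpperSet_self
    intro x hx
    by_cases hxU : x ∈ U
    · exact ihU (fun z hz => hw z (hmax.1.subset hz)) (fun V hV => hc V (hV.trans hmax.1)) x hxU
    · exact (ihL (fun z hz => hw z (Finset.sdiff_subset hz)) (fun V => hmax.deviation_nonpos) x
        (Finset.mem_sdiff.2 ⟨hx, hxU⟩)).trans hbc

theorem ge_of_forall_deviation_le (h : SplitFit w y g S) (hw : ∀ x ∈ S, 0 < w x)
    (hc : ∀ V, IsUpperSubset S V → deviation w y c V ≤ deviation w y c S) :
    ∀ x ∈ S, c ≤ g x := by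
  have hnonneg : 0 ≤ deviation w y c S := by
    simpa [deviation] using hc ∅ (by simp [IsUpperSubset])
  induction h generalizing c with
  | flat S b hne hS hg =>
    intro x hx
    rwa [hg x hx, ← deviation_le_deviation_iff hne hw, hS.1]
  | split S U b hb hmax _ hU ihL ihU =>
    have hLU : deviation w y c S = deviation w y c (S \ U) + deviation w y c U := by
      rw [← deviation_union_of_subset_sdiff c subset_rfl,
        Finset.sdiff_union_of_subset hmax.1.subset]
    have hcL : ∀ V, IsUpperSubset (S \ U) V → deviation w y c V ≤ deviation w y c (S \ U) := by
      intro V hV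
      have := hc _ (hmax.1.union hV)
      rwa [deviation_union_of_subset_sdiff c hV.subset, hLU, add_le_add_iff_right] at this
    have hcb : c ≤ b := by
      rwa [← deviation_le_deviation_iff (hU.nonempty.mono hmax.1.subset) hw, hb]
    intro x hx
    by_cases hxU : x ∈ U
    · have hwU : ∀ x ∈ U, 0 < w x := fun z hz => hw z (hmax.1.subset hz)
      have hb_nonneg : 0 ≤ deviation w y b U := hb.symm.trans_le (hmax.2 S isRelUpperSet_self)
      exact hcb.trans (ihU hwU (fun V hV => hmax.2 V (hV.trans hmax.1)) hb_nonneg x hxU)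
    · exact ihL (fun z hz => hw z (Finset.sdiff_subset hz)) hcL
        (by simpa [deviation] using hcL ∅ (by simp [IsUpperSubset])) x
        (Finset.mem_sdiff.2 ⟨hx, hxU⟩)

theorem le_of_isMaximalUpperSubset (hL : SplitFit w y g (S \ U)) (hw : ∀ x ∈ S, 0 < w x)
    (hmax : IsMaximalUpperSubset w y b S U) : ∀ x ∈ S \ U, g x ≤ b :=
  hL.le_of_forall_deviation_nonpos (fun x hx => hw x (Finset.sdiff_subset hx)) fun _ =>
    hmax.deviation_nonpos

theorem ge_of_isMaximalUpperSubset (hU : SplitFit w y g U) (hw : ∀ x ∈ S, 0 < w x)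
    (hmax : IsMaximalUpperSubset w y b S U) : ∀ x ∈ U, b ≤ g x :=
  hU.ge_of_forall_deviation_le (fun x hx => hw x (hmax.1.subset hx)) fun V hV =>
    hmax.2 V (hV.trans hmax.1)

theorem mem_Icc (h : SplitFit w y g S) (hw : ∀ x ∈ S, 0 < w x)
    (hy : ∀ x ∈ S, y x ∈ Set.Icc b c) : ∀ x ∈ S, g x ∈ Set.Icc b c := by
  refine fun x hx => ⟨h.ge_of_forall_deviation_le hw (fun V hV => ?_) x hx,
    h.le_of_forall_deviation_nonpos hw (fun V hV => ?_) x hx⟩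
  · exact Finset.sum_le_sum_of_subset_of_nonneg hV.subset fun z hz _ =>
      mul_nonneg (hw z hz).le (sub_nonneg.2 (hy z hz).1)
  · exact Finset.sum_nonpos fun z hz => mul_nonpos_of_nonneg_of_nonpos (hw z (hV.subset hz)).le
      (sub_nonpos.2 (hy z (hV.subset hz)).2)

theorem monotoneOn (h : SplitFit w y g S) (hw : ∀ x ∈ S, 0 < w x) : MonotoneOn g S := by
  induction h with
  | flat S b _ _ hg => exact fun x hx z hz _ => ((hg x hx).trans (hg z hz).symm).le
  | split S U b _ hmax hL hU ihL ihU =>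
    intro x hx z hz hxz
    rw [Finset.mem_coe] at hx hz
    by_cases hxU : x ∈ U
    · exact ihU (fun v hv => hw v (hmax.1.subset hv)) hxU ((hmax.1 hxU).2 hxz hz) hxz
    have hxL : x ∈ S \ U := Finset.mem_sdiff.2 ⟨hx, hxU⟩
    by_cases hzU : z ∈ U
    · exact (hL.le_of_isMaximalUpperSubset hw hmax x hxL).trans
        (hU.ge_of_isMaximalUpperSubset hw hmax z hzU)
    · exact ihL (fun v hv => hw v (Finset.sdiff_subset hv)) hxL (Finset.mem_sdiff.2 ⟨hz, hzU⟩) hxz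

theorem sum_sq_le (h : SplitFit w y g S) (hw : ∀ x ∈ S, 0 < w x) {f : ι → R}
    (hf : MonotoneOn f S) :
    ∑ x ∈ S, w x * (g x - y x) ^ 2 ≤ ∑ x ∈ S, w x * (f x - y x) ^ 2 := by
  refine h.sum_le_sum fun B hBS b _ hB hg => ?_
  have hexpand : ∑ x ∈ B, w x * (f x - y x) ^ 2 = ∑ x ∈ B, w x * (g x - y x) ^ 2 +
      ∑ x ∈ B, w x * (f x - b) ^ 2 - 2 * ∑ x ∈ B, w x * (y x - b) * (f x - b) := by
    rw [Finset.mul_sum, ← Finset.sum_add_distrib, ← Finset.sum_sub_distrib]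
    exact Finset.sum_congr rfl fun x hx => by rw [hg x hx]; ring
  have hsq : 0 ≤ ∑ x ∈ B, w x * (f x - b) ^ 2 :=
    Finset.sum_nonneg fun x hx => mul_nonneg (hw x (hBS hx)).le (sq_nonneg _)
  have hcorr := hB.sum_mul_nonpos (hf.mono (Finset.coe_subset.2 hBS))
  linarith

end SplitFit

end Isotonic

/-! ### The logarithmic loss -/

section LogLoss

/-- The Bernoulli negative log-likelihood of the probability `t` for the observation `y`. -/
noncomputable def logLoss (y t : ℝ) : ENNReal :=
  ENNReal.ofReal y * negLog t + ENNReal.ofReal (1 - y) * negLog (1 - t)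

theorem logLoss_zero_zero : logLoss 0 0 = 0 := by simp [logLoss, negLog]

theorem logLoss_one_one : logLoss 1 1 = 0 := by simp [logLoss, negLog]

/-- The real-valued logarithmic loss; at `t = 0` and `t = 1` its value is junk, as
`Real.log 0 = 0`. -/
noncomputable def crossEntropy (y t : ℝ) : ℝ := y * -Real.log t + (1 - y) * -Real.log (1 - t)

variable {y b t : ℝ}

theorem crossEntropy_nonneg (hy : y ∈ Set.Icc (0 : ℝ) 1) (hb : b ∈ Set.Ioo (0 : ℝ) 1) :
    0 ≤ crossEntropy y b :=
  add_nonneg (mul_nonneg hy.1 (neg_nonneg.2 (Real.log_nonpos hb.1.le hb.2.le)))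
    (mul_nonneg (sub_nonneg.2 hy.2)
      (neg_nonneg.2 (Real.log_nonpos (sub_nonneg.2 hb.2.le) (sub_le_self 1 hb.1.le))))

theorem logLoss_eq_ofReal (hy : y ∈ Set.Icc (0 : ℝ) 1) (hb : b ∈ Set.Ioo (0 : ℝ) 1) :
    logLoss y b = ENNReal.ofReal (crossEntropy y b) := by
  have hb' : 1 - b ∈ Set.Ioo (0 : ℝ) 1 := ⟨sub_pos.2 hb.2, sub_lt_self 1 hb.1⟩
  have hlog {t : ℝ} (ht : t ∈ Set.Ioo (0 : ℝ) 1) : 0 ≤ -Real.log t :=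
    neg_nonneg.2 (Real.log_nonpos ht.1.le ht.2.le)
  have hy' := sub_nonneg.2 hy.2
  rw [logLoss, negLog, negLog, if_pos hb.1, if_pos hb'.1, crossEntropy,
    ENNReal.ofReal_add (mul_nonneg hy.1 (hlog hb)) (mul_nonneg hy' (hlog hb')),
    ENNReal.ofReal_mul hy.1, ENNReal.ofReal_mul hy']

theorem ofReal_tangent_le_negLog (hb : 0 < b) :
    ENNReal.ofReal (-Real.log b - (t - b) / b) ≤ negLog t := by
  unfold negLog
  split_ifs with ht
  · refine ENNReal.ofReal_le_ofReal ?_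
    have hlog := Real.log_le_sub_one_of_pos (div_pos ht hb)
    rw [Real.log_div ht.ne' hb.ne'] at hlog
    rw [sub_div, div_self hb.ne']
    linarith
  · exact le_top

theorem ofReal_tangent_le_logLoss (hy : y ∈ Set.Icc (0 : ℝ) 1) (hb : b ∈ Set.Ioo (0 : ℝ) 1) :
    ENNReal.ofReal (crossEntropy y b - (y - b) * (t - b) / (b * (1 - b))) ≤ logLoss y t := by
  have hb' : 0 < 1 - b := sub_pos.2 hb.2
  have htangent : crossEntropy y b - (y - b) * (t - b) / (b * (1 - b)) =
      y * (-Real.log b - (t - b) / b) +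
        (1 - y) * (-Real.log (1 - b) - (1 - t - (1 - b)) / (1 - b)) := by
    have := hb.1.ne'
    have := hb'.ne'
    unfold crossEntropy
    field_simp
    ring
  rw [htangent]
  refine ENNReal.ofReal_add_le.trans ?_
  rw [ENNReal.ofReal_mul hy.1, ENNReal.ofReal_mul (sub_nonneg.2 hy.2)]
  exact add_le_add (mul_le_mul_right (ofReal_tangent_le_negLog hb.1) _)
    (mul_le_mul_right (ofReal_tangent_le_negLog hb') _)

variable {ι : Type*} [Preorder ι] {w y g f : ι → ℝ} {S : Finset ι}

theorem IsFlat.sum_logLoss_le (hS : IsFlat w y b S) (hb : b ∈ Set.Ioo (0 : ℝ) 1)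
    (hw : ∀ x ∈ S, 0 ≤ w x) (hy : ∀ x ∈ S, y x ∈ Set.Icc (0 : ℝ) 1) (hf : MonotoneOn f S) :
    ∑ x ∈ S, ENNReal.ofReal (w x) * logLoss (y x) b ≤
      ∑ x ∈ S, ENNReal.ofReal (w x) * logLoss (y x) (f x) := by
  set tangent : ι → ℝ := fun x =>
    crossEntropy (y x) b - (y x - b) * (f x - b) / (b * (1 - b)) with htangent
  have hsum : ∑ x ∈ S, w x * crossEntropy (y x) b ≤ ∑ x ∈ S, w x * tangent x := by
    have hcorr : (∑ x ∈ S, w x * (y x - b) * (f x - b)) / (b * (1 - b)) ≤ 0 :=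
      div_nonpos_of_nonpos_of_nonneg (hS.sum_mul_nonpos hf) (mul_pos hb.1 (sub_pos.2 hb.2)).le
    rw [← sub_nonneg, ← Finset.sum_sub_distrib]
    refine (neg_nonneg.2 hcorr).trans_eq ?_
    rw [Finset.sum_div, ← Finset.sum_neg_distrib]
    exact Finset.sum_congr rfl fun x _ => by rw [htangent]; ring
  calc ∑ x ∈ S, ENNReal.ofReal (w x) * logLoss (y x) b
      = ENNReal.ofReal (∑ x ∈ S, w x * crossEntropy (y x) b) := by
        rw [ENNReal.ofReal_sum_of_nonneg fun x hx =>
          mul_nonneg (hw x hx) (crossEntropy_nonneg (hy x hx) hb)]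
        exact Finset.sum_congr rfl fun x hx => by
          rw [logLoss_eq_ofReal (hy x hx) hb, ENNReal.ofReal_mul (hw x hx)]
    _ ≤ ENNReal.ofReal (∑ x ∈ S, w x * tangent x) := ENNReal.ofReal_le_ofReal hsum
    _ ≤ ∑ x ∈ S, ENNReal.ofReal (w x * tangent x) :=
        Finset.le_sum_of_subadditive ENNReal.ofReal ENNReal.ofReal_zero.le
          (fun _ _ => ENNReal.ofReal_add_le) S _
    _ ≤ ∑ x ∈ S, ENNReal.ofReal (w x) * logLoss (y x) (f x) := by
        refine Finset.sum_le_sum fun x hx => ?_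
        rw [ENNReal.ofReal_mul (hw x hx)]
        exact mul_le_mul_right (ofReal_tangent_le_logLoss (hy x hx) hb) _

theorem SplitFit.sum_logLoss_le [DecidableEq ι] (h : SplitFit w y g S) (hw : ∀ x ∈ S, 0 < w x)
    (hy : ∀ x ∈ S, y x ∈ Set.Icc (0 : ℝ) 1) (hf : MonotoneOn f S) :
    ∑ x ∈ S, ENNReal.ofReal (w x) * logLoss (y x) (g x) ≤
      ∑ x ∈ S, ENNReal.ofReal (w x) * logLoss (y x) (f x) := by
  refine h.sum_le_sum fun B hBS b hne hB hg => ?_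
  have hwB : ∀ x ∈ B, 0 < w x := fun x hx => hw x (hBS hx)
  have hyB : ∀ x ∈ B, y x ∈ Set.Icc (0 : ℝ) 1 := fun x hx => hy x (hBS hx)
  obtain ⟨x₀, hx₀⟩ := hne
  have hb : b ∈ Set.Icc (0 : ℝ) 1 := hg x₀ hx₀ ▸ h.mem_Icc hw hy x₀ (hBS hx₀)
  rw [Finset.sum_congr rfl fun x hx => by rw [hg x hx]]
  -- On a block with mean `0` or `1` all observations equal the mean, and the loss vanishes.
  rcases hb.1.eq_or_lt with rfl | hb₀
  · rw [Finset.sum_eq_zero fun x hx => by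
      rw [eq_of_deviation_eq_zero_of_ge hwB (fun z hz => (hyB z hz).1) hB.1 x hx,
        logLoss_zero_zero, mul_zero]]
    exact zero_le
  rcases hb.2.eq_or_lt with rfl | hb₁
  · rw [Finset.sum_eq_zero fun x hx => by
      rw [eq_of_deviation_eq_zero_of_le hwB (fun z hz => (hyB z hz).2) hB.1 x hx,
        logLoss_one_one, mul_zero]]
    exact zero_le
  exact hB.sum_logLoss_le ⟨hb₀, hb₁⟩ (fun x hx => (hwB x hx).le) hyB
    (hf.mono (Finset.coe_subset.2 hBS))

end LogLoss

/-! ### Correctness of the splitting procedure -/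

section SplittingCorrectness

noncomputable instance : DecidableEq (Pt ℝ) := Classical.decEq _

variable {k : ℕ} {X U : List (Pt ℝ)}

theorem IsGrid.weight_pos (hX : IsGrid k X) : ∀ x ∈ X.toFinset, 0 < x.w := fun x hx =>
  (hX.2 x (List.mem_toFinset.1 hx)).2.2

theorem IsGrid.excess_eq_deviation (hX : IsGrid k X) (hU : U.Sublist X) :
    excess X U = deviation Pt.w Pt.y (avg X) U.toFinset :=
  (List.sum_toFinset _ (hX.sublist hU).nodup).symm

theorem IsGrid.deviation_avg (hX : IsGrid k X) (hX₀ : X ≠ []) :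
    deviation Pt.w Pt.y (avg X) X.toFinset = 0 := by
  have hpos : 0 < ∑ x ∈ X.toFinset, x.w :=
    Finset.sum_pos hX.weight_pos ((List.toFinset_nonempty_iff X).2 hX₀)
  simp only [deviation, mul_sub, Finset.sum_sub_distrib, ← Finset.sum_mul, avg,
    ← List.sum_toFinset _ hX.nodup]
  rw [mul_div_cancel₀ _ hpos.ne', sub_self]

theorem IsGrid.exists_comp_pos_eq {β : Type*} [Nonempty β] (hX : IsGrid k X) (g : Pt ℝ → β) :
    ∃ f : ℝ × ℕ → β, ∀ x ∈ X, f x.pos = g x := by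
  have hinj : Function.Injective fun x : {x // x ∈ X} => x.1.pos := fun x z h =>
    Subtype.ext (List.inj_on_of_nodup_map hX.nodup_map_pos x.2 z.2 h)
  exact ⟨Function.extend (fun x : {x // x ∈ X} => x.1.pos) (fun x => g x.1)
    fun _ => Classical.arbitrary β, fun x hx => hinj.extend_apply _ _ ⟨x, hx⟩⟩

theorem IsMaximalUpperSet.toFinset (hU : IsMaximalUpperSet X U) (hX : IsGrid k X) :
    IsMaximalUpperSubset Pt.w Pt.y (avg X) X.toFinset U.toFinset := by
  refine ⟨fun x hx => ?_, fun V hV => ?_⟩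
  · simp only [List.coe_toFinset, Set.mem_ofPred_eq, List.mem_toFinset] at hx ⊢
    exact ⟨hU.1.1.subset hx, fun z hxz hz => hU.1.2 x hx z hz hxz⟩
  have hsub : (X.filter (· ∈ V)).Sublist X := List.filter_sublist
  have hfin : (X.filter (· ∈ V)).toFinset = V := by
    ext x
    simpa using fun hx => List.mem_toFinset.1 (hV.subset hx)
  have hup : IsUpperIn X (X.filter (· ∈ V)) := by
    refine ⟨hsub, fun x hx z hz hxz => ?_⟩
    simp only [List.mem_filter, decide_eq_true_eq] at hx ⊢
    exact ⟨hz, (hV hx.2).2 hxz (List.mem_toFinset.2 hz)⟩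
  have hle := hU.2 _ hup
  rwa [hX.excess_eq_deviation hsub, hX.excess_eq_deviation hU.1.1, hfin] at hle

theorem IsGrid.toFinset_sdiff_snd (hX : IsGrid k X) :
    X.toFinset \ (maxUpperSetT k X).val.2.toFinset = (maxUpperSetT k X).val.1.toFinset := by
  have hperm := maxUpperSetT_perm k X
  have hdisj := (List.nodup_append'.1 (hperm.nodup_iff.2 hX.nodup)).2.2
  rw [← List.toFinset_eq_of_perm _ _ hperm, List.toFinset_append, Finset.union_sdiff_right,
    Finset.sdiff_eq_self_of_disjoint (List.disjoint_toFinset_iff_disjoint.2 hdisj)]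

theorem IsGrid.isMaximalUpperSubset_snd (hX : IsGrid k X) (hX₀ : X ≠ []) :
    IsMaximalUpperSubset Pt.w Pt.y (avg X) X.toFinset (maxUpperSetT k X).val.2.toFinset :=
  (isMaximalUpperSet_maxUpperSetT hX (hX.pos_of_ne_nil hX₀)).toFinset hX

theorem IsGrid.snd_sublist (hX : IsGrid k X) (hX₀ : X ≠ []) :
    (maxUpperSetT k X).val.2.Sublist X :=
  (isMaximalUpperSet_maxUpperSetT hX (hX.pos_of_ne_nil hX₀)).1.1

theorem IsGrid.isFlat_of_eq_nil (hX : IsGrid k X) (hX₀ : X ≠ [])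
    (h : (maxUpperSetT k X).val.1 = [] ∨ (maxUpperSetT k X).val.2 = []) :
    IsFlat Pt.w Pt.y (avg X) X.toFinset := by
  have havg := hX.deviation_avg hX₀
  refine ⟨havg, fun V hV => ((hX.isMaximalUpperSubset_snd hX₀).2 V hV).trans_eq ?_⟩
  rcases h with h | h
  · have hperm := maxUpperSetT_perm k X
    rw [h, List.nil_append] at hperm
    rwa [List.toFinset_eq_of_perm _ _ hperm]
  · simp [h, deviation]

theorem IsGrid.exists_splitFit (hX : IsGrid k X) {depth : ℕ} (hd : X.length ≤ depth)
    (hX₀ : X ≠ []) :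
    ∃ g : Pt ℝ → ℝ, SplitFit Pt.w Pt.y g X.toFinset ∧
      (splitSolveT k depth X).val.Perm (X.map fun x => (x.pos, g x)) := by
  induction depth generalizing X with
  | zero => exact absurd (List.length_eq_zero_iff.1 (Nat.le_zero.1 hd)) hX₀
  | succ depth ih =>
    by_cases h : (maxUpperSetT k X).val.1 = [] ∨ (maxUpperSetT k X).val.2 = []
    · refine ⟨fun _ => avg X, .flat _ (avg X) ((List.toFinset_nonempty_iff X).2 hX₀)
        (hX.isFlat_of_eq_nil hX₀ h) fun _ _ => rfl, ?_⟩
      simp [splitSolveT_succ_of_eq_nil depth h, Pt.pos]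
    obtain ⟨hL₀, hU₀⟩ := not_or.1 h
    have hadd := maxUpperSetT_length_add k X
    have hL_pos := List.length_pos_iff.2 hL₀
    have hU_pos := List.length_pos_iff.2 hU₀
    obtain ⟨gL, hgL, hpL⟩ := ih (hX.sublist (maxUpperSetT_fst_sublist k X)) (by lia) hL₀
    obtain ⟨gU, hgU, hpU⟩ := ih (hX.sublist (hX.snd_sublist hX₀)) (by lia) hU₀
    rw [← hX.toFinset_sdiff_snd] at hgL
    refine ⟨_, .split_piecewise (hX.deviation_avg hX₀) (hX.isMaximalUpperSubset_snd hX₀) hgL hgU,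
      ?_⟩
    simp only [splitSolveT_succ_of_ne_nil depth hL₀ hU₀, bind_val, appendT_val]
    refine .trans ?_ ((maxUpperSetT_perm k X).map _)
    rw [List.map_append]
    refine .append (hpL.trans (.of_eq ?_)) (hpU.trans (.of_eq ?_)) <;>
      refine List.map_congr_left fun x hx => ?_
    · have hxL := hX.toFinset_sdiff_snd ▸ List.mem_toFinset.2 hx
      rw [Finset.piecewise_eq_of_notMem _ _ _ (Finset.mem_sdiff.1 hxL).2]
    · rw [Finset.piecewise_eq_of_mem _ _ _ (List.mem_toFinset.2 hx)]

theorem isotonicOn_iff_monotoneOn {f : ℝ × ℕ → ℝ} :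
    IsotonicOn X f ↔ MonotoneOn (fun x : Pt ℝ => f x.pos) X.toFinset := by
  simp only [IsotonicOn, MonotoneOn, List.coe_toFinset, Set.mem_ofPred_eq]
  exact ⟨fun hf x hx z hz hxz => hf x hx z hz hxz, fun hf x hx z hz => hf hx hz⟩

theorem SplitFit.isIsotonicRegression {g : ℝ × ℕ → ℝ}
    (h : SplitFit Pt.w Pt.y (fun x => g x.pos) X.toFinset) (hX : IsGrid k X) :
    IsIsotonicRegression X g := by
  refine ⟨isotonicOn_iff_monotoneOn.2 (h.monotoneOn hX.weight_pos), fun f hf => ?_⟩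
  rw [← List.sum_toFinset _ hX.nodup, ← List.sum_toFinset _ hX.nodup]
  exact h.sum_sq_le hX.weight_pos (isotonicOn_iff_monotoneOn.1 hf)

theorem IsGrid.exists_splitFit_pos (hX : IsGrid k X) (hX₀ : X ≠ []) :
    ∃ g : ℝ × ℕ → ℝ, SplitFit Pt.w Pt.y (fun x => g x.pos) X.toFinset ∧
      (splitSolveT k X.length X).val.Perm (X.map fun x => (x.pos, g x.pos)) := by
  obtain ⟨g, hg, hperm⟩ := hX.exists_splitFit le_rfl hX₀
  obtain ⟨f, hf⟩ := hX.exists_comp_pos_eq g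
  refine ⟨f, hg.congr fun x hx => hf x (List.mem_toFinset.1 hx), hperm.trans (.of_eq ?_)⟩
  exact List.map_congr_left fun x hx => by rw [hf x hx]

theorem IsGrid.isLowerIn_fst (hX : IsGrid k X) (hX₀ : X ≠ []) :
    IsLowerIn X (maxUpperSetT k X).val.1 := by
  refine ⟨maxUpperSetT_fst_sublist k X, fun x hx z hz hzx => ?_⟩
  rw [← List.mem_toFinset, ← hX.toFinset_sdiff_snd, Finset.mem_sdiff] at hx ⊢
  exact ⟨List.mem_toFinset.2 hz, fun hzU =>
    hx.2 (((hX.isMaximalUpperSubset_snd hX₀).1 hzU).2 hzx hx.1)⟩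

theorem IsGrid.isProjectionPair (hX : IsGrid k X) (hL₀ : (maxUpperSetT k X).val.1 ≠ [])
    (hU₀ : (maxUpperSetT k X).val.2 ≠ []) :
    IsProjectionPair X (maxUpperSetT k X).val.1 (maxUpperSetT k X).val.2 := by
  have hX₀ : X ≠ [] := fun h => hL₀ (List.sublist_nil.1 (h ▸ maxUpperSetT_fst_sublist k X))
  have hmax := hX.isMaximalUpperSubset_snd hX₀
  have hLgrid := hX.sublist (maxUpperSetT_fst_sublist k X)
  have hUgrid := hX.sublist (hX.snd_sublist hX₀)
  obtain ⟨fL, hfL, -⟩ := hLgrid.exists_splitFit_pos hL₀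
  obtain ⟨fU, hfU, -⟩ := hUgrid.exists_splitFit_pos hU₀
  refine ⟨maxUpperSetT_perm k X, hX.isLowerIn_fst hX₀,
    (isMaximalUpperSet_maxUpperSetT hX (hX.pos_of_ne_nil hX₀)).1, fL, fU,
    hfL.isIsotonicRegression hLgrid, hfU.isIsotonicRegression hUgrid, avg X,
    fun x hx z hz => ⟨?_, ?_⟩⟩
  · rw [← hX.toFinset_sdiff_snd] at hfL
    exact hfL.le_of_isMaximalUpperSubset hX.weight_pos hmax x
      (hX.toFinset_sdiff_snd ▸ List.mem_toFinset.2 hx)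
  · exact hfU.ge_of_isMaximalUpperSubset hX.weight_pos hmax z (List.mem_toFinset.2 hz)

end SplittingCorrectness

/-! ### Aggregation of the calibration data -/

section SortedClasses

theorem sortT_val_eq_of_pairwise_lt {α β : Type} [LinearOrder β] {before : α → α → Timed Bool}
    {key : α → β} (hkey : ∀ a b, (before a b).val = decide (key a < key b)) {l l' : List α}
    (hperm : l'.Perm l) (hlt : l'.Pairwise fun a b => key a < key b) :
    (sortT before l).val = l' := by
  have hsort := (sortT_perm before l).trans hperm.symm
  have hinj : (l'.map key).Nodup := List.pairwise_map.2 (hlt.imp ne_of_lt)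
  exact hsort.eq_of_pairwise
    (fun a b ha hb hab hba =>
      List.inj_on_of_nodup_map hinj (hsort.mem_iff.1 ha) hb (le_antisymm hab hba))
    (sortT_pairwise_le before key hkey l) (hlt.imp le_of_lt)

/-- The key by which the classes are sorted: decreasing score, then increasing tie-break. -/
def ClassEntry.key (e : ClassEntry ℝ) : ℝᵒᵈ ×ₗ ℕ := toLex (OrderDual.toDual e.score, e.tie)

theorem ClassEntry.key_lt_key_iff {a b : ClassEntry ℝ} :
    a.key < b.key ↔ b.score < a.score ∨ a.score = b.score ∧ a.tie < b.tie := by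
  simp [key, Prod.Lex.toLex_lt_toLex]

theorem classBeforeT_val (a b : ClassEntry ℝ) :
    (classBeforeT a b).val = decide (a.key < b.key) := by
  simp only [ClassEntry.key_lt_key_iff, classBeforeT, bind_val, ltT_val, decide_eq_true_eq,
    apply_ite Timed.val, pure_val, natLtT_val]
  rcases lt_trichotomy a.score b.score with h | h | h
  · simp [h, h.not_gt, h.ne]
  · simp [h]
  · simp [h]

theorem sortT_classBeforeT_val {k : ℕ} {p : Fin k → ℝ} {σ : Equiv.Perm (Fin k)}
    (hσ : IsOrderPerm p σ) (y : Fin k → ℝ) :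
    (sortT classBeforeT (List.ofFn fun j => (⟨p j, σ j, y j⟩ : ClassEntry ℝ))).val =
      List.ofFn fun s => ⟨p (σ.symm s), s, y (σ.symm s)⟩ := by
  refine sortT_val_eq_of_pairwise_lt classBeforeT_val ?_ (List.pairwise_ofFn.2 fun s t hst => ?_)
  · refine .trans (.of_eq ?_) (Equiv.Perm.ofFn_comp_perm σ.symm _)
    simp [Function.comp_def]
  · exact ClassEntry.key_lt_key_iff.2 ((hσ hst.le).lt_or_eq.imp_right fun h => ⟨h.symm, hst⟩)

end SortedClasses

section CumulativeData

theorem cumulateT_val (r : ℕ) (q y : ℝ) (l : List (ClassEntry ℝ)) :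
    (cumulateT r q y l).val = (List.range (l.length - 1)).map fun t =>
      ⟨q + ((l.map ClassEntry.score).take (t + 1)).sum, r + t + 1,
        y + ((l.map ClassEntry.label).take (t + 1)).sum, 1⟩ := by
  induction l generalizing r q y with
  | nil => simp [cumulateT]
  | cons e l ih =>
    cases l with
    | nil => simp [cumulateT]
    | cons e' l =>
      simp [cumulateT, ih, List.range_succ_eq_map, Function.comp_def, add_assoc, add_comm 1]

variable {k : ℕ} (σ : Equiv.Perm (Fin k))

theorem topSum_eq_sum_take_ofFn (v : Fin k → ℝ) (r : ℕ) :
    topSum σ v r = ((List.ofFn (v ∘ σ.symm)).take r).sum := by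
  rw [List.sum_take_ofFn, topSum]
  exact Finset.sum_equiv σ (by simp) (by simp)

theorem topSum_mem_Icc {v : Fin k → ℝ} (hv : v ∈ stdSimplex ℝ (Fin k)) (r : ℕ) :
    topSum σ v r ∈ Set.Icc (0 : ℝ) 1 :=
  ⟨Finset.sum_nonneg fun j _ => hv.1 j,
    (Finset.sum_le_univ_sum_of_nonneg hv.1).trans_eq hv.2⟩

/-- The sorted cumulative data of one calibration point, before aggregation. -/
noncomputable def cumulativeData (p y : Fin k → ℝ) : List (Pt ℝ) :=
  (List.range (k - 1)).map fun t => ⟨topSum σ p (t + 1), t + 1, topSum σ y (t + 1), 1⟩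

theorem mem_cumulativeData {p y : Fin k → ℝ} {x : Pt ℝ} :
    x ∈ cumulativeData σ p y ↔ ∃ r ∈ Finset.Ico 1 k, x = ⟨topSum σ p r, r, topSum σ y r, 1⟩ := by
  simp only [cumulativeData, List.mem_map, List.mem_range, Finset.mem_Ico]
  constructor
  · rintro ⟨t, ht, rfl⟩
    exact ⟨t + 1, by lia, rfl⟩
  · rintro ⟨r, hr, rfl⟩
    exact ⟨r - 1, by lia, by rw [Nat.sub_add_cancel hr.1]⟩

theorem cumulateT_sortT_val {p : Fin k → ℝ} {σ : Equiv.Perm (Fin k)} (hσ : IsOrderPerm p σ)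
    (y : Fin k → ℝ) :
    (cumulateT 0 0 0 (sortT classBeforeT
      (List.ofFn fun j => (⟨p j, σ j, y j⟩ : ClassEntry ℝ))).val).val = cumulativeData σ p y := by
  simp only [sortT_classBeforeT_val hσ, cumulateT_val, cumulativeData, topSum_eq_sum_take_ofFn,
    List.length_ofFn, List.map_ofFn, zero_add]
  rfl

theorem collectT_val {R : Type} [Field R] [LinearOrder R] (V : List (List (ClassEntry R))) :
    (collectT V).val =
      (V.map fun s => (cumulateT 0 0 0 (sortT classBeforeT s).val).val).flatten := by
  induction V with
  | nil => simp [collectT]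
  | cons s V ih => simp [collectT, ih]

variable {m : ℕ} {p y : Fin m → Fin k → ℝ} {σ : Fin m → Equiv.Perm (Fin k)}

theorem collectT_inputData_val (hσ : ∀ i, IsOrderPerm (p i) (σ i)) :
    (collectT (inputData p y σ)).val =
      (List.ofFn fun i => cumulativeData (σ i) (p i) (y i)).flatten := by
  simp only [collectT_val, inputData, List.map_ofFn, Function.comp_def, cumulateT_sortT_val (hσ _)]

theorem mem_collectT_inputData (hσ : ∀ i, IsOrderPerm (p i) (σ i)) {x : Pt ℝ} :
    x ∈ (collectT (inputData p y σ)).val ↔ ∃ i, ∃ r ∈ Finset.Ico 1 k,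
      x = ⟨topSum (σ i) (p i) r, r, topSum (σ i) (y i) r, 1⟩ := by
  simp only [collectT_inputData_val hσ, List.mem_flatten, List.mem_ofFn, exists_exists_eq_and,
    mem_cumulativeData]

/-- The logarithmic loss of the predictions `f` on weighted data. -/
noncomputable def totalLoss (f : ℝ × ℕ → ℝ) (X : List (Pt ℝ)) : ENNReal :=
  (X.map fun x => ENNReal.ofReal x.w * logLoss x.y (f x.pos)).sum

theorem totalLoss_cons (f : ℝ × ℕ → ℝ) (x : Pt ℝ) (X : List (Pt ℝ)) :
    totalLoss f (x :: X) = ENNReal.ofReal x.w * logLoss x.y (f x.pos) + totalLoss f X := by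
  simp [totalLoss]

theorem totalLoss_cumulativeData (σ : Equiv.Perm (Fin k)) (p y : Fin k → ℝ) (f : ℝ × ℕ → ℝ) :
    totalLoss f (cumulativeData σ p y) =
      ∑ r ∈ Finset.Ico 1 k, logLoss (topSum σ y r) (f (topSum σ p r, r)) := by
  rw [Finset.sum_Ico_eq_sum_range, ← List.toFinset_range, List.sum_toFinset _ List.nodup_range]
  simp [totalLoss, cumulativeData, Pt.pos, Function.comp_def, add_comm]

theorem nll_eq_totalLoss_collectT (hσ : ∀ i, IsOrderPerm (p i) (σ i)) (f : ℝ × ℕ → ℝ) :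
    nll p y σ f = totalLoss f (collectT (inputData p y σ)).val := by
  rw [collectT_inputData_val hσ, totalLoss, List.map_flatten, List.sum_flatten, List.map_ofFn,
    List.map_ofFn, List.sum_ofFn]
  exact Finset.sum_congr rfl fun i _ => (totalLoss_cumulativeData (σ i) (p i) (y i) f).symm

end CumulativeData

section Pooling

theorem ofReal_mul_logLoss {w : ℝ} (hw : 0 ≤ w) (y t : ℝ) :
    ENNReal.ofReal w * logLoss y t =
      ENNReal.ofReal (w * y) * negLog t + ENNReal.ofReal (w * (1 - y)) * negLog (1 - t) := by
  rw [logLoss, mul_add, ← mul_assoc, ← mul_assoc, ENNReal.ofReal_mul hw, ENNReal.ofReal_mul hw]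

/-- Admissible data for the logarithmic loss: positive weight and value in `[0,1]`. -/
structure Pt.IsProper (x : Pt ℝ) : Prop where
  weight_pos : 0 < x.w
  value_mem : x.y ∈ Set.Icc (0 : ℝ) 1

variable {x z : Pt ℝ} {X : List (Pt ℝ)}

theorem poolT_isProper (hx : x.IsProper) (hz : z.IsProper) : (poolT x z).val.IsProper := by
  refine ⟨add_pos hx.1 hz.1, ?_⟩
  have hconvex := convex_Icc (0 : ℝ) 1 hx.2 hz.2
    (div_nonneg hx.1.le (add_pos hx.1 hz.1).le) (div_nonneg hz.1.le (add_pos hx.1 hz.1).le)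
    (by rw [← add_div, div_self (add_pos hx.1 hz.1).ne'])
  convert hconvex using 1
  simp only [poolT, bind_val, mulT_val, addT_val, divT_val, pure_val, smul_eq_mul]
  ring

theorem poolT_logLoss (hx : x.IsProper) (hz : z.IsProper) (t : ℝ) :
    ENNReal.ofReal (poolT x z).val.w * logLoss (poolT x z).val.y t =
      ENNReal.ofReal x.w * logLoss x.y t + ENNReal.ofReal z.w * logLoss z.y t := by
  have hw : x.w + z.w ≠ 0 := (add_pos hx.1 hz.1).ne'
  have hsucc : (poolT x z).val.w * (poolT x z).val.y = x.w * x.y + z.w * z.y :=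
    mul_div_cancel₀ _ hw
  have hfail : (poolT x z).val.w * (1 - (poolT x z).val.y) =
      x.w * (1 - x.y) + z.w * (1 - z.y) := by
    rw [mul_sub, hsucc]
    simp only [poolT, bind_val, addT_val, pure_val]
    ring
  rw [ofReal_mul_logLoss (poolT_isProper hx hz).1.le, ofReal_mul_logLoss hx.1.le,
    ofReal_mul_logLoss hz.1.le, hsucc, hfail,
    ENNReal.ofReal_add (mul_nonneg hx.1.le hx.2.1) (mul_nonneg hz.1.le hz.2.1),
    ENNReal.ofReal_add (mul_nonneg hx.1.le (sub_nonneg.2 hx.2.2))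
      (mul_nonneg hz.1.le (sub_nonneg.2 hz.2.2))]
  ring

theorem mergeT_isProper (hX : ∀ x ∈ X, x.IsProper) : ∀ z ∈ (mergeT X).val, z.IsProper := by
  induction X using mergeT_induction with
  | nil => exact hX
  | keep x X Z _ ih _ =>
    rw [List.forall_mem_cons] at hX ⊢
    exact ⟨hX.1, ih hX.2⟩
  | pool x X z Z _ ih _ =>
    rw [List.forall_mem_cons] at hX ih ⊢
    exact ⟨poolT_isProper hX.1 (ih hX.2).1, (ih hX.2).2⟩

theorem totalLoss_mergeT (hX : ∀ x ∈ X, x.IsProper) (f : ℝ × ℕ → ℝ) :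
    totalLoss f (mergeT X).val = totalLoss f X := by
  induction X using mergeT_induction with
  | nil => rfl
  | keep x X Z _ ih _ =>
    rw [totalLoss_cons, totalLoss_cons, ih (List.forall_mem_cons.1 hX).2]
  | pool x X z Z hZ ih hxz =>
    obtain ⟨hx, hX⟩ := List.forall_mem_cons.1 hX
    have hz : z.IsProper := mergeT_isProper hX z (by simp [hZ])
    have hpos : (poolT x z).val.pos = x.pos := rfl
    rw [totalLoss_cons, totalLoss_cons, ← ih hX, totalLoss_cons, poolT_logLoss hx hz, hpos,
      show z.pos = x.pos from (Prod.ext hxz.1 hxz.2).symm, add_assoc]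

theorem mem_map_pos_mergeT (X : List (Pt ℝ)) (s : ℝ × ℕ) :
    s ∈ (mergeT X).val.map Pt.pos ↔ s ∈ X.map Pt.pos := by
  induction X using mergeT_induction with
  | nil => rfl
  | keep x X Z _ ih _ => simp only [List.map_cons, List.mem_cons, ih]
  | pool x X z Z _ ih hxz =>
    have hpos : x.pos = z.pos := Prod.ext hxz.1 hxz.2
    have hpool : (poolT x z).val.pos = z.pos := hpos
    rw [List.map_cons, List.mem_cons] at ih
    rw [List.map_cons, List.map_cons, List.mem_cons, List.mem_cons, ← ih, hpos, hpool,
      or_self_left]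

theorem mergeT_pairwise_lexPos_lt (hX : X.Pairwise fun x z => x.lexPos ≤ z.lexPos) :
    (mergeT X).val.Pairwise fun x z => x.lexPos < z.lexPos := by
  induction X using mergeT_induction with
  | nil => exact .nil
  | keep x X Z hZ ih hhead =>
    obtain ⟨hx, hX⟩ := List.pairwise_cons.1 hX
    cases Z with
    | nil => exact List.pairwise_singleton _ _
    | cons z Z =>
      have hlt : x.lexPos < z.lexPos := by
        obtain ⟨a, ha, haz⟩ := List.mem_map.1 ((mem_map_pos_mergeT X z.pos).1 (by simp [hZ]))
        exact ((hx a ha).trans_eq (congrArg toLex haz)).lt_of_ne fun h =>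
          hhead z rfl (Prod.mk.inj h)
      exact .cons (List.forall_mem_cons.2 ⟨hlt, fun a ha =>
        hlt.trans ((List.pairwise_cons.1 (ih hX)).1 a ha)⟩) (ih hX)
  | pool x X z Z _ ih hxz =>
    rw [List.pairwise_cons] at hX ih
    have hpool : (poolT x z).val.lexPos = z.lexPos := congrArg toLex (Prod.ext hxz.1 hxz.2)
    exact List.pairwise_cons.2 ⟨fun a ha => hpool ▸ (ih hX.2).1 a ha, (ih hX.2).2⟩

end Pooling

section Aggregation

theorem ptBeforeT_val (x z : Pt ℝ) : (ptBeforeT x z).val = decide (x.lexPos < z.lexPos) := by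
  simp only [Pt.lexPos_lt_lexPos_iff, ptBeforeT, bind_val, ltT_val, decide_eq_true_eq,
    apply_ite Timed.val, pure_val, natLtT_val]
  rcases lt_trichotomy x.q z.q with h | h | h
  · simp [h]
  · simp [h]
  · simp [h, h.not_gt, h.ne']

variable {m k : ℕ} {p y : Fin m → Fin k → ℝ} {σ : Fin m → Equiv.Perm (Fin k)}

theorem isProper_of_mem_sortT_collectT (hσ : ∀ i, IsOrderPerm (p i) (σ i))
    (hy : ∀ i, y i ∈ stdSimplex ℝ (Fin k)) :
    ∀ x ∈ (sortT ptBeforeT (collectT (inputData p y σ)).val).val, x.IsProper := fun x hx => by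
  obtain ⟨i, r, -, rfl⟩ := (mem_collectT_inputData hσ).1 ((sortT_perm _ _).mem_iff.1 hx)
  exact ⟨one_pos, topSum_mem_Icc (σ i) (hy i) r⟩

theorem mem_map_pos_aggregateT (hσ : ∀ i, IsOrderPerm (p i) (σ i)) (s : ℝ × ℕ) :
    s ∈ (aggregateT (inputData p y σ)).val.map Pt.pos ↔
      ∃ i, ∃ r ∈ Finset.Ico 1 k, s = (topSum (σ i) (p i) r, r) := by
  refine (mem_map_pos_mergeT _ s).trans (((sortT_perm _ _).map Pt.pos).mem_iff.trans ?_)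
  simp only [List.mem_map, mem_collectT_inputData hσ]
  constructor
  · rintro ⟨x, ⟨i, r, hr, rfl⟩, rfl⟩
    exact ⟨i, r, hr, rfl⟩
  · rintro ⟨i, r, hr, rfl⟩
    exact ⟨_, ⟨i, r, hr, rfl⟩, rfl⟩

theorem aggregateT_isProper (hσ : ∀ i, IsOrderPerm (p i) (σ i))
    (hy : ∀ i, y i ∈ stdSimplex ℝ (Fin k)) :
    ∀ x ∈ (aggregateT (inputData p y σ)).val, x.IsProper :=
  mergeT_isProper (isProper_of_mem_sortT_collectT hσ hy)

theorem isGrid_aggregateT (hσ : ∀ i, IsOrderPerm (p i) (σ i))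
    (hy : ∀ i, y i ∈ stdSimplex ℝ (Fin k)) : IsGrid k (aggregateT (inputData p y σ)).val := by
  refine ⟨(mergeT_pairwise_lexPos_lt (sortT_pairwise_le ptBeforeT Pt.lexPos ptBeforeT_val _)).imp
    Pt.lexPos_lt_lexPos_iff.1, fun x hx => ?_⟩
  obtain ⟨i, r, hr, hpos⟩ := (mem_map_pos_aggregateT hσ x.pos).1 (List.mem_map_of_mem hx)
  obtain rfl : x.r = r := congrArg Prod.snd hpos
  rw [Finset.mem_Ico] at hr
  exact ⟨hr.1, hr.2, (aggregateT_isProper hσ hy x hx).1⟩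

theorem nll_eq_totalLoss_aggregateT (hσ : ∀ i, IsOrderPerm (p i) (σ i))
    (hy : ∀ i, y i ∈ stdSimplex ℝ (Fin k)) (f : ℝ × ℕ → ℝ) :
    nll p y σ f = totalLoss f (aggregateT (inputData p y σ)).val := by
  rw [nll_eq_totalLoss_collectT hσ]
  refine .trans ?_ (totalLoss_mergeT (isProper_of_mem_sortT_collectT hσ hy) f).symm
  exact ((sortT_perm _ _).map _).sum_eq.symm

end Aggregation

/-! ### The whole method -/

section Method

theorem exists_monotone_extension_Icc {α β : Type*} [Preorder α] [ConditionallyCompleteLattice β]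
    {f : α → β} {S : Set α} {a b : β} (hab : a ≤ b) (hf : MonotoneOn f S)
    (hfS : Set.MapsTo f S (Set.Icc a b)) :
    ∃ g : α → β, Monotone g ∧ (∀ x, g x ∈ Set.Icc a b) ∧ Set.EqOn g f S := by
  set lower : α → Set β := fun x => insert a (f '' (S ∩ Set.Iic x)) with hlower
  have hle : ∀ x, ∀ t ∈ lower x, t ≤ b := by
    rintro x t (rfl | ⟨z, hz, rfl⟩)
    exacts [hab, (hfS hz.1).2]
  have hbdd : ∀ x, BddAbove (lower x) := fun x => ⟨b, hle x⟩
  have ha : ∀ x, a ∈ lower x := fun x => Set.mem_insert _ _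
  refine ⟨fun x => sSup (lower x), fun x z hxz => ?_, fun x => ?_, fun x hx => ?_⟩
  · refine csSup_le_csSup (hbdd z) ⟨a, ha x⟩ ?_
    simp only [hlower]
    gcongr
  · exact ⟨le_csSup (hbdd x) (ha x), csSup_le ⟨a, ha x⟩ (hle x)⟩
  · refine IsGreatest.csSup_eq ⟨Or.inr ⟨x, ⟨hx, le_rfl⟩, rfl⟩, ?_⟩
    rintro t (rfl | ⟨z, hz, rfl⟩)
    exacts [(hfS hx).1, hf hz.1 hx hz.2]

variable {k : ℕ}

theorem IsGrid.exists_isotonic_totalLoss_le {X : List (Pt ℝ)} (hX : IsGrid k X)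
    (hproper : ∀ x ∈ X, x.IsProper) :
    ∃ g : ℝ × ℕ → ℝ, Monotone g ∧ (∀ s, g s ∈ Set.Icc (0 : ℝ) 1) ∧
      (∀ f, IsotonicOn X f → totalLoss g X ≤ totalLoss f X) ∧
      (splitSolveT k X.length X).val.Perm (X.map fun x => (x.pos, g x.pos)) := by
  obtain rfl | hX₀ := eq_or_ne X []
  · exact ⟨fun _ => 0, monotone_const, by simp, fun _ _ => le_rfl, .refl _⟩
  obtain ⟨g, hg, hperm⟩ := hX.exists_splitFit_pos hX₀
  have hy : ∀ x ∈ X.toFinset, x.y ∈ Set.Icc (0 : ℝ) 1 := fun x hx =>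
    (hproper x (List.mem_toFinset.1 hx)).value_mem
  have hmono : MonotoneOn g {s | s ∈ X.map Pt.pos} := by
    have hiso := (hg.isIsotonicRegression hX).1
    simpa [MonotoneOn, IsotonicOn] using hiso
  have hmaps : Set.MapsTo g {s | s ∈ X.map Pt.pos} (Set.Icc 0 1) := fun s hs => by
    obtain ⟨x, hx, rfl⟩ := List.mem_map.1 hs
    exact hg.mem_Icc hX.weight_pos hy x (List.mem_toFinset.2 hx)
  obtain ⟨f, hf, hfI, hfg⟩ := exists_monotone_extension_Icc zero_le_one hmono hmaps
  have hfg_pos : ∀ x ∈ X, f x.pos = g x.pos := fun x hx => hfg (List.mem_map_of_mem hx)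
  refine ⟨f, hf, hfI, fun h hh => ?_, hperm.trans (.of_eq ?_)⟩
  · rw [totalLoss, totalLoss, ← List.sum_toFinset _ hX.nodup, ← List.sum_toFinset _ hX.nodup]
    exact (hg.congr fun x hx => hfg_pos x (List.mem_toFinset.1 hx)).sum_logLoss_le hX.weight_pos
      hy (isotonicOn_iff_monotoneOn.1 hh)
  · exact List.map_congr_left fun x hx => by rw [hfg_pos x hx]

variable {m : ℕ} {p y : Fin m → Fin k → ℝ} {σ : Fin m → Equiv.Perm (Fin k)}

theorem inputData_length : (inputData p y σ).length = m := by simp [inputData]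

theorem length_of_mem_inputData : ∀ s ∈ inputData p y σ, s.length = k := by simp [inputData]

theorem Feasible.isotonicOn_aggregateT {g : ℝ × ℕ → ℝ} (hg : Feasible k g)
    (hσ : ∀ i, IsOrderPerm (p i) (σ i)) (hp : ∀ i, p i ∈ stdSimplex ℝ (Fin k)) :
    IsotonicOn (aggregateT (inputData p y σ)).val g := by
  have hdomain : ∀ x ∈ (aggregateT (inputData p y σ)).val, x.pos ∈ domain k := fun x hx => by
    obtain ⟨i, r, hr, hpos⟩ := (mem_map_pos_aggregateT hσ x.pos).1 (List.mem_map_of_mem hx)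
    exact hpos ▸ ⟨topSum_mem_Icc (σ i) (hp i) r, Finset.mem_Ico.1 hr⟩
  exact fun x hx z hz hxz => hg.2 (hdomain x hx) (hdomain z hz) hxz

theorem exists_isSolution_fitT (hσ : ∀ i, IsOrderPerm (p i) (σ i))
    (hp : ∀ i, p i ∈ stdSimplex ℝ (Fin k)) (hy : ∀ i, y i ∈ stdSimplex ℝ (Fin k)) :
    ∃ g : ℝ × ℕ → ℝ, IsSolution p y σ g ∧ ∀ e, e ∈ (fitT k (inputData p y σ)).val ↔
      ∃ i, ∃ r ∈ Finset.Ico 1 k,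
        e = ((topSum (σ i) (p i) r, r), g (topSum (σ i) (p i) r, r)) := by
  obtain ⟨g, hg, hgI, hmin, hperm⟩ :=
    (isGrid_aggregateT hσ hy).exists_isotonic_totalLoss_le (aggregateT_isProper hσ hy)
  refine ⟨g, ⟨⟨fun s _ => hgI s, hg.monotoneOn _⟩, fun h hh => ?_⟩, fun e => ?_⟩
  · rw [nll_eq_totalLoss_aggregateT hσ hy, nll_eq_totalLoss_aggregateT hσ hy]
    exact hmin h (hh.isotonicOn_aggregateT hσ hp)
  · have htable : e ∈ (fitT k (inputData p y σ)).val ↔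
        ∃ s ∈ (aggregateT (inputData p y σ)).val.map Pt.pos, (s, g s) = e := by
      refine hperm.mem_iff.trans ?_
      simp only [List.mem_map, exists_exists_and_eq_and]
    rw [htable]
    simp only [mem_map_pos_aggregateT hσ]
    constructor
    · rintro ⟨_, ⟨i, r, hr, rfl⟩, rfl⟩
      exact ⟨i, r, hr, rfl⟩
    · rintro ⟨i, r, hr, rfl⟩
      exact ⟨_, ⟨i, r, hr, rfl⟩, rfl⟩

end Method

end SCIR

theorem mainTheorem1_general :
    ∃ C : ℕ,
      (∀ (k : ℕ) (X : List (SCIR.Pt ℝ)), X ≠ [] → SCIR.IsGrid k X →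
        ∀ L U : List (SCIR.Pt ℝ), (SCIR.maxUpperSetT k X).val = (L, U) →
          (L ++ U).Perm X ∧ L.Sublist X ∧ SCIR.IsMaximalUpperSet X U ∧
          (L ≠ [] → U ≠ [] → SCIR.IsProjectionPair X L U) ∧
          (SCIR.maxUpperSetT k X).steps ≤ C * (X.length * k)) ∧
      (∀ (m k : ℕ), 0 < m → ∀ (p y : Fin m → Fin k → ℝ) (σ : Fin m → Equiv.Perm (Fin k)),
        (∀ i, p i ∈ stdSimplex ℝ (Fin k)) → (∀ i, SCIR.IsOrderPerm (p i) (σ i)) →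
        (∀ i, y i ∈ stdSimplex ℝ (Fin k)) →
          SCIR.IsGrid k (SCIR.aggregateT (SCIR.inputData p y σ)).val ∧
          (SCIR.aggregateT (SCIR.inputData p y σ)).val.length ≤ m * (k - 1) ∧
          (∃ g : ℝ × ℕ → ℝ, SCIR.IsSolution p y σ g ∧
            ∀ e : (ℝ × ℕ) × ℝ, e ∈ (SCIR.fitT k (SCIR.inputData p y σ)).val ↔
              ∃ i : Fin m, ∃ r ∈ Finset.Ico 1 k,
                e = ((SCIR.topSum (σ i) (p i) r, r), g (SCIR.topSum (σ i) (p i) r, r))) ∧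
          (SCIR.fitT k (SCIR.inputData p y σ)).steps ≤ C * (m ^ 2 * k ^ 4)) := by
  refine ⟨120, fun k X hX₀ hX L U hLU => ?_, fun m k hm p y σ hp hσ hy => ?_⟩
  · obtain rfl : (SCIR.maxUpperSetT k X).val.1 = L := congrArg Prod.fst hLU
    obtain rfl : (SCIR.maxUpperSetT k X).val.2 = U := congrArg Prod.snd hLU
    have hk : 0 < k := hX.pos_of_ne_nil hX₀
    exact ⟨SCIR.maxUpperSetT_perm k X, SCIR.maxUpperSetT_fst_sublist k X,
      SCIR.isMaximalUpperSet_maxUpperSetT hX hk, hX.isProjectionPair,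
      (SCIR.maxUpperSetT_steps_le hk hX₀).trans (Nat.mul_le_mul_right _ (by norm_num))⟩
  · have hk : 0 < k := by
      obtain ⟨j, -⟩ := Finset.nonempty_of_sum_ne_zero ((hp ⟨0, hm⟩).2.trans_ne one_ne_zero)
      exact j.pos
    have hV := SCIR.length_of_mem_inputData (p := p) (y := y) (σ := σ)
    have hlen : (SCIR.inputData p y σ).length = m := SCIR.inputData_length
    have hV₀ : SCIR.inputData p y σ ≠ [] := List.length_pos_iff.1 (hm.trans_eq hlen.symm)
    exact ⟨SCIR.isGrid_aggregateT hσ hy, (SCIR.aggregateT_length_le hV).trans_eq (by rw [hlen]),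
      SCIR.exists_isSolution_fitT hσ hp hy, (SCIR.fitT_steps_le hV hk hV₀).trans_eq (by rw [hlen])⟩

theorem mainTheorem1 :
    ∃ C : ℕ,
      -- every run of the dynamic program yields a maximal upper set, in linear time in the table
      (∀ (k : ℕ) (X : List (SCIR.Pt ℝ)), X ≠ [] → SCIR.IsGrid k X →
        ∀ L U : List (SCIR.Pt ℝ), (SCIR.maxUpperSetT k X).val = (L, U) →
          (L ++ U).Perm X ∧ L.Sublist X ∧ SCIR.IsMaximalUpperSet X U ∧
          (L ≠ [] → U ≠ [] → SCIR.IsProjectionPair X L U) ∧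
          (SCIR.maxUpperSetT k X).steps ≤ C * (X.length * k)) ∧
      -- the whole method, for every calibration set
      (∀ (m k : ℕ), 0 < m → ∀ (p : Fin m → Fin k → ℝ) (label : Fin m → Fin k)
        (σ : Fin m → Equiv.Perm (Fin k)),
        (∀ i, p i ∈ stdSimplex ℝ (Fin k)) → (∀ i, SCIR.IsOrderPerm (p i) (σ i)) →
        ∀ y : Fin m → Fin k → ℝ, (∀ i, y i = SCIR.oneHot (label i)) →
          -- the dynamic program is applied to sublists of a grid of at most `m (k-1)` points
          SCIR.IsGrid k (SCIR.aggregateT (SCIR.inputData p y σ)).val ∧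
          (SCIR.aggregateT (SCIR.inputData p y σ)).val.length ≤ m * (k - 1) ∧
          -- the output is a solution of the problem, tabulated at the data positions
          (∃ g : ℝ × ℕ → ℝ, SCIR.IsSolution p y σ g ∧
            ∀ e : (ℝ × ℕ) × ℝ, e ∈ (SCIR.fitT k (SCIR.inputData p y σ)).val ↔
              ∃ i : Fin m, ∃ r ∈ Finset.Ico 1 k,
                e = ((SCIR.topSum (σ i) (p i) r, r), g (SCIR.topSum (σ i) (p i) r, r))) ∧
          (SCIR.fitT k (SCIR.inputData p y σ)).steps ≤ C * (m ^ 2 * k ^ 4)) := by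
  obtain ⟨C, hsplit, hmethod⟩ := mainTheorem1_general
  exact ⟨C, hsplit, fun m k hm p label σ hp hσ y hy => hmethod m k hm p y σ hp hσ fun i =>
    hy i ▸ single_mem_stdSimplex ℝ (label i)⟩
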